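/- Let $\Sigma_+=\{z\in\mathbb C:|z|<1\}$, $\Sigma_c=\{z\in\mathbb C:|z|>1,\ |z-2|>1\}$ and $\Sigma_-=\{z\in\mathbb C:|z-2|<1\}$ be the three zones bounded by the externally tangent circles $|z|=1$ and $|z-2|=1$. Consider, for complex polynomials $h^+,h^c,h^-$ of degree at most $4$ and real $\varepsilon$, the piecewise holomorphic system $$\dot z=-i(z-1)+\varepsilon h^{\sigma}(z),\qquad z\in\Sigma_\sigma,\quad \sigma=+,c,-,$$ with the dynamics on the two circles given by Filippov's convention: solutions are locally absolutely continuous curves whose velocity lies, at almost every time, in the convex hull of the values at the current point of the fields of all zones whose closure contains that point. A periodic orbit is the trace of a nonconstant periodic solution, and a limit cycle is a periodic orbit having a neighbourhood that contains no other periodic orbit. For $\varepsilon=0$ the circles $|z-1|=\rho$ are periodic orbits of the center $\dot z=-i(z-1)$; those with $0<\rho<2$ cross both discontinuity circles. Then at least $5$ limit cycles can bifurcate from the periodic orbits of the center: there are polynomials $h^+,h^c,h^-$ of degree at most $4$, five distinct radii $\rho_1,\dots,\rho_5\in(0,2)$ and $\varepsilon_0>0$ such that for every real $\varepsilon$ with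 $0<|\varepsilon|<\varepsilon_0$ the system has five distinct limit cycles $\Gamma_1(\varepsilon),\dots,\Gamma_5(\varepsilon)$, where, for each $i$, $\Gamma_i(\varepsilon)$ tends to the circle $|z-1|=\rho_i$ in the Hausdorff distance as $\varepsilon\to0$. -/

import Mathlib

/-- Labels of the three zones. -/
inductive Zone
  | plus
  | center
  | minus

/-- The three open zones cut out by the externally tangent circles `|z| = 1` and `|z - 2| = 1`. -/
def zoneSet : Zone → Set ℂ
  | Zone.plus => {z | ‖z‖ < 1}
  | Zone.center => {z | 1 < ‖z‖ ∧ 1 < ‖z - 2‖}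
  | Zone.minus => {z | ‖z - 2‖ < 1}

/-- The vector field `-i (z - 1) + ε h^σ(z)` of the zone `σ`. -/
noncomputable def perturbedCenter (h : Zone → Polynomial ℂ) (ε : ℝ) (σ : Zone) (z : ℂ) : ℂ :=
  -Complex.I * (z - 1) + (ε : ℂ) * (h σ).eval z

/-- Filippov's convention for the piecewise system `z' = X σ z`, `z ∈ zoneSet σ` (each `X σ`
continuous on the plane): the set of admissible velocities at `z` is the convex hull of the limit
values at `z` of the field, one for each zone whose closure contains `z`. In an open zone `σ` it
is `{X σ z}`. -/
def filippovField (X : Zone → ℂ → ℂ) (z : ℂ) : Set ℂ :=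
  convexHull ℝ {v | ∃ σ : Zone, z ∈ closure (zoneSet σ) ∧ v = X σ z}

/-- `γ` is a Filippov solution, defined for all times: it is locally absolutely continuous and
satisfies the differential inclusion `γ' ∈ filippovField X γ` almost everywhere. -/
def IsFilippovSolution (X : Zone → ℂ → ℂ) (γ : ℝ → ℂ) : Prop :=
  (∀ a b : ℝ, AbsolutelyContinuousOnInterval γ a b) ∧
    ∀ᵐ t : ℝ, ∃ v ∈ filippovField X (γ t), HasDerivAt γ v t

/-- `Γ` is a periodic orbit: the trace of a nonconstant periodic solution. -/
def IsPeriodicOrbit (X : Zone → ℂ → ℂ) (Γ : Set ℂ) : Prop :=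
  ∃ (γ : ℝ → ℂ) (T : ℝ), IsFilippovSolution X γ ∧ 0 < T ∧ Function.Periodic γ T ∧
    (∃ s t : ℝ, γ s ≠ γ t) ∧ Γ = Set.range γ

/-- `Γ` is a limit cycle: a periodic orbit which has a neighbourhood that contains no other
periodic orbit. -/
def IsLimitCycle (X : Zone → ℂ → ℂ) (Γ : Set ℂ) : Prop :=
  IsPeriodicOrbit X Γ ∧
    ∃ U : Set ℂ, IsOpen U ∧ Γ ⊆ U ∧ ∀ Γ' : Set ℂ, IsPeriodicOrbit X Γ' → Γ' ⊆ U → Γ' = Γ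

/-!
In the coordinate `w = z - 1 = e^u` the unperturbed center is the translation `u' = -i`. The
perturbation is chosen to be `a w` in both outer zones and a real polynomial `p(w)` of degree four
inside the disc `|z| < 1`, so that only the circle `|z| = 1` is a true discontinuity line. In
logarithmic coordinates the system reads `u' = -i + ε a` outside and `u' = -i + ε q(u)` inside,
with `q(u) = p(e^u) e^{-u}`. Both pieces have explicit first integrals: the outer orbits are
spirals, and the imaginary part of the complex time `T`, a holomorphic primitive of
`1 / (-i + ε q)`, is constant along the inner ones.

A closed orbit which crosses `|z| = 1` at `log |w| = x` (upwards) and `log |w| = y` (downwards)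
corresponds to a solution of two equations in `(x, y)`, obtained by equating the first integrals
at the two crossings (`Linked`). Their difference is divisible by `ε`; after the division the
equations (`crossingMap`) are a Lipschitz-small perturbation of a system at `ε = 0` whose zeros are
the pairs `(x, x)` with `melnikov x = 0`. A simple zero `x₀` of `melnikov` therefore gives, for each
small `ε ≠ 0`, exactly one solution near `(x₀, x₀)` (`exists_zero_of_lipschitz_perturbation`).

That solution gives a periodic orbit: the inner arc is obtained by inverting `T`, and the two arcs
are glued into a periodic Lipschitz curve (`Linked.exists_isPeriodicOrbit`). Conversely, a periodic
Filippov orbit in a thin annulus lifts to `u`, moves with velocity close to `-i`, and hence crosses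
the circle transversally, once in each direction per turn. The return map between upward crossings
is strictly increasing, so a periodic sequence of crossings is constant, and the orbit is the curve
of a solution of the crossing equations (`IsPeriodicOrbit.eq_image_returnCurve`). This makes the
periodic orbit the only one in a fixed annulus, a limit cycle.

In the variable `X = ρ / 2` the displacement functions are all the combinations of `1`,
`arccos (-X)` and `√(1 - X²) X^j` for `j = -1, 1, 3, 5`. Being six-dimensional, this space has a
nonzero element vanishing at five prescribed points of `(0, 1)`. Its derivative is, up to a positive
factor, a polynomial of degree at most four in `X²`; by Rolle's theorem a double zero would
give this polynomial five roots, so the five zeros are simple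
(`displacementNumerator_eval_ne_zero`).
-/

/-! ### Filippov velocities and logarithmic lifts -/

/-- A Filippov velocity at a point strictly outside the disc `|z| ≤ 1` is the value of the common
field of the two outer zones. -/
theorem eq_of_mem_filippovField_of_one_lt {X : Zone → ℂ → ℂ} {z v : ℂ}
    (hX : X Zone.minus z = X Zone.center z) (hz : 1 < ‖z‖) (hv : v ∈ filippovField X z) :
    v = X Zone.center z := by
  have hsub : {v | ∃ σ : Zone, z ∈ closure (zoneSet σ) ∧ v = X σ z} ⊆ {X Zone.center z} := by
    rintro w ⟨σ, hσ, rfl⟩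
    cases σ with
    | plus =>
      have h1 : closure (zoneSet Zone.plus) ⊆ {z : ℂ | ‖z‖ ≤ 1} :=
        closure_minimal (fun w (hw : ‖w‖ < 1) => hw.le)
          (isClosed_le continuous_norm continuous_const)
      exact absurd (h1 hσ) (not_le.mpr hz)
    | center => rfl
    | minus => exact hX
  simpa using convexHull_min hsub (convex_singleton _) hv

/-- A Filippov velocity at a point of the disc `|z| < 1` is the value of the inner field. -/
theorem eq_of_mem_filippovField_of_lt_one {X : Zone → ℂ → ℂ} {z v : ℂ}
    (hz : ‖z‖ < 1) (hv : v ∈ filippovField X z) : v = X Zone.plus z := by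
  have hsub : {v | ∃ σ : Zone, z ∈ closure (zoneSet σ) ∧ v = X σ z} ⊆ {X Zone.plus z} := by
    rintro w ⟨σ, hσ, rfl⟩
    cases σ with
    | plus => rfl
    | center =>
      have h1 : closure (zoneSet Zone.center) ⊆ {z : ℂ | 1 ≤ ‖z‖} :=
        closure_minimal (fun w hw => (hw : 1 < ‖w‖ ∧ 1 < ‖w - 2‖).1.le)
          (isClosed_le continuous_const continuous_norm)
      exact absurd (h1 hσ) (not_le.mpr hz)
    | minus =>
      have h1 : closure (zoneSet Zone.minus) ⊆ {z : ℂ | ‖z - 2‖ ≤ 1} :=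
        closure_minimal (fun w (hw : ‖w - 2‖ < 1) => hw.le)
          (isClosed_le (by fun_prop) continuous_const)
      have h2 : ‖z - 2‖ ≤ 1 := h1 hσ
      have h3 : ‖(2 : ℂ)‖ ≤ ‖z‖ + ‖z - 2‖ := by
        have := norm_sub_le z (z - 2)
        simpa using this
      norm_num at h3
      linarith
  simpa using convexHull_min hsub (convex_singleton _) hv

theorem plus_mem_filippovField {X : Zone → ℂ → ℂ} {z : ℂ} (hz : ‖z‖ < 1) :
    X Zone.plus z ∈ filippovField X z :=
  subset_convexHull ℝ _ ⟨Zone.plus, subset_closure hz, rfl⟩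

theorem center_mem_filippovField {X : Zone → ℂ → ℂ} {z : ℂ}
    (hX : X Zone.minus z = X Zone.center z) (hz : 1 < ‖z‖) :
    X Zone.center z ∈ filippovField X z := by
  rcases lt_or_ge 1 ‖z - 2‖ with h | h
  · exact subset_convexHull ℝ _ ⟨Zone.center, subset_closure ⟨hz, h⟩, rfl⟩
  · refine subset_convexHull ℝ _ ⟨Zone.minus, ?_, hX.symm⟩
    have : zoneSet Zone.minus = Metric.ball (2 : ℂ) 1 := by
      ext w; simp [zoneSet, dist_eq_norm]
    rw [this, closure_ball _ one_ne_zero]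
    simpa [dist_eq_norm] using h

/-- All Filippov velocities are close to the unperturbed one: a bound on the perturbing
polynomials at `z` bounds the distance. -/
theorem norm_sub_le_of_mem_filippovField {h : Zone → Polynomial ℂ} {ε b : ℝ} {z v : ℂ}
    (hb : ∀ σ, ‖(h σ).eval z‖ ≤ b) (hv : v ∈ filippovField (perturbedCenter h ε) z) :
    ‖v + Complex.I * (z - 1)‖ ≤ |ε| * b := by
  have hsub : {v | ∃ σ : Zone, z ∈ closure (zoneSet σ) ∧ v = perturbedCenter h ε σ z} ⊆
      Metric.closedBall (-Complex.I * (z - 1)) (|ε| * b) := by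
    rintro w ⟨σ, -, rfl⟩
    rw [mem_closedBall_iff_norm, perturbedCenter, add_sub_cancel_left, norm_mul,
      Complex.norm_real, Real.norm_eq_abs]
    exact mul_le_mul_of_nonneg_left (hb σ) (abs_nonneg _)
  have := convexHull_min hsub (convex_closedBall _ _) hv
  rw [mem_closedBall_iff_norm] at this
  simpa [sub_eq_add_neg] using this

open MeasureTheory in
/-- A locally absolutely continuous curve which avoids `1` and whose logarithmic derivative about
`1` is almost everywhere within `η` of `-i` has a logarithm which is Lipschitz and moves with
nearly constant velocity `-i`. -/
theorem exists_log_lift {γ : ℝ → ℂ} {η : ℝ}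
    (hac : ∀ a b : ℝ, AbsolutelyContinuousOnInterval γ a b) (h1 : ∀ t, γ t ≠ 1)
    (hd : ∀ᵐ t : ℝ, ∃ v, HasDerivAt γ v t ∧ ‖v / (γ t - 1) + Complex.I‖ ≤ η) :
    ∃ u : ℝ → ℂ, (∀ t, Complex.exp (u t) = γ t - 1) ∧
      (∀ s t, ‖u t - u s + ((t - s : ℝ) : ℂ) * Complex.I‖ ≤ η * |t - s|) ∧
      ∀ᵐ t : ℝ, HasDerivAt u (deriv γ t / (γ t - 1)) t := by
  set f : ℝ → ℂ := fun t => deriv γ t / (γ t - 1) with hf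
  have hγc : Continuous γ := by
    rw [continuous_iff_continuousAt]
    intro t
    exact (hac (t - 1) (t + 1)).continuousOn.continuousAt (by
      rw [Set.uIcc_of_le (by linarith)]
      exact Icc_mem_nhds (by linarith) (by linarith))
  have hfm : AEStronglyMeasurable f volume := by
    refine ((measurable_deriv γ).div ?_).aestronglyMeasurable
    exact (hγc.sub continuous_const).measurable
  have hfb : ∀ᵐ t : ℝ, ‖f t + Complex.I‖ ≤ η := by
    filter_upwards [hd] with t ⟨v, hv, hb⟩
    rw [hf]; simp only [hv.deriv]; exact hb
  have hfn : ∀ᵐ t : ℝ, ‖f t‖ ≤ η + 1 := by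
    filter_upwards [hfb] with t ht
    calc ‖f t‖ = ‖f t + Complex.I - Complex.I‖ := by simp
      _ ≤ ‖f t + Complex.I‖ + ‖Complex.I‖ := norm_sub_le _ _
      _ ≤ η + 1 := by simpa using ht
  have hint : LocallyIntegrable f volume := by
    refine (locallyIntegrable_const (η + 1 : ℝ)).mono hfm ?_
    filter_upwards [hfn] with t ht
    exact ht.trans (le_abs_self _)
  have hii : ∀ a b, IntervalIntegrable f volume a b := fun a b =>
    intervalIntegrable_iff.mpr
      ((hint.integrableOn_isCompact isCompact_uIcc).mono_set Set.uIoc_subset_uIcc)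
  set u : ℝ → ℂ := fun t => Complex.log (γ 0 - 1) + ∫ s in (0 : ℝ)..t, f s with hu
  have hrot : ∀ s t, ‖u t - u s + ((t - s : ℝ) : ℂ) * Complex.I‖ ≤ η * |t - s| := by
    intro s t
    have : u t - u s + ((t - s : ℝ) : ℂ) * Complex.I = ∫ r in s..t, (f r + Complex.I) := by
      rw [intervalIntegral.integral_add (hii s t) intervalIntegrable_const,
        intervalIntegral.integral_const]
      simp only [hu, add_sub_add_left_eq_sub,
        intervalIntegral.integral_interval_sub_left (hii 0 t) (hii 0 s)]
      simp
    rw [this]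
    refine intervalIntegral.norm_integral_le_of_norm_le_const_ae ?_
    filter_upwards [hfb] with r hr _ using hr
  have hder : ∀ᵐ t : ℝ, HasDerivAt u (f t) t := by
    filter_upwards [_root_.LocallyIntegrable.ae_hasDerivAt_integral hint] with t ht
    exact (ht 0).const_add _
  have hlip : LipschitzWith (Real.toNNReal (η + 1)) u := by
    refine LipschitzWith.of_dist_le_mul fun t s => ?_
    have hη : 0 ≤ η := by
      have := (norm_nonneg _).trans (hrot 0 1)
      simpa using this
    rw [Real.coe_toNNReal _ (by linarith), dist_eq_norm, Real.dist_eq]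
    calc ‖u t - u s‖ = ‖(u t - u s + ((t - s : ℝ) : ℂ) * Complex.I) -
          ((t - s : ℝ) : ℂ) * Complex.I‖ := by rw [add_sub_cancel_right]
      _ ≤ η * |t - s| + |t - s| := by
          refine (norm_sub_le _ _).trans (add_le_add (hrot s t) ?_)
          rw [norm_mul, Complex.norm_real]; simp
      _ = (η + 1) * |t - s| := by ring
  refine ⟨u, ?_, hrot, hder⟩
  -- `exp (-u) (γ - 1)` is absolutely continuous with vanishing derivative, hence constant.
  intro t
  have hexp : AbsolutelyContinuousOnInterval (fun t => Complex.exp (-u t)) 0 t := by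
    obtain ⟨R, hR⟩ : ∃ R, ∀ s ∈ Set.uIcc 0 t, ‖-u s‖ ≤ R :=
      isCompact_uIcc.exists_bound_of_continuousOn hlip.continuous.neg.continuousOn
    obtain ⟨K, hK⟩ := (Complex.contDiff_exp (n := 1) (𝕜 := ℝ)).contDiffOn.exists_lipschitzOnWith
      (by decide) (convex_closedBall (0 : ℂ) R) (isCompact_closedBall 0 R)
    refine LipschitzOnWith.absolutelyContinuousOnInterval
      (hK.comp (hlip.neg.lipschitzOnWith (s := Set.uIcc 0 t)) ?_)
    intro s hs
    simpa using hR s hs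
  have hprod := hexp.fun_smul ((hac 0 t).sub
    ((LipschitzWith.const (1 : ℂ)).lipschitzOnWith.absolutelyContinuousOnInterval
      (K := 0) (a := 0) (b := t)))
  obtain ⟨c, hc⟩ := hprod.const_of_ae_hasDerivAt_zero (by
    filter_upwards [hder, hd] with s hs ⟨v, hv, _⟩ _
    have h2 := (hs.neg.cexp).smul (hv.sub (hasDerivAt_const s (1 : ℂ)))
    convert! h2 using 1
    have h3 : γ s - 1 ≠ 0 := sub_ne_zero.mpr (h1 s)
    simp only [hf, hv.deriv, smul_eq_mul, Pi.sub_apply, Pi.neg_apply]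
    field_simp
    ring)
  have h0 := hc 0 Set.left_mem_uIcc
  have ht := hc t Set.right_mem_uIcc
  have h3 : γ 0 - 1 ≠ 0 := sub_ne_zero.mpr (h1 0)
  rw [← h0] at ht
  simp only [hu, intervalIntegral.integral_same, add_zero, smul_eq_mul, Pi.sub_apply,
    Complex.exp_neg, Complex.exp_log h3] at ht ⊢
  rw [inv_mul_cancel₀ h3] at ht
  field_simp at ht
  exact ht.symm

/-! ### Crossings of the circle in logarithmic coordinates -/

/-- The argument, in `[0, π]`, of the points `w` with `|w + 1| = 1` and `log |w| = x`. -/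
noncomputable def crossAngle (x : ℝ) : ℝ := Real.arccos (-(Real.exp x) / 2)

/-- The logarithm of the point of `|w + 1| = 1` with `log |w| = x` in the upper half plane. -/
noncomputable def upperCrossing (x : ℝ) : ℂ := ⟨x, crossAngle x⟩

/-- The logarithm of the point of `|w + 1| = 1` with `log |w| = y` in the lower half plane, with
argument in `[π, 2π]`. -/
noncomputable def lowerCrossing (y : ℝ) : ℂ := ⟨y, 2 * Real.pi - crossAngle y⟩

theorem crossAngle_nonneg (x : ℝ) : 0 ≤ crossAngle x := Real.arccos_nonneg _

theorem crossAngle_le_pi (x : ℝ) : crossAngle x ≤ Real.pi := Real.arccos_le_pi _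

theorem crossAngle_pos (x : ℝ) : 0 < crossAngle x := by
  rw [crossAngle, Real.arccos_pos]
  have := Real.exp_pos x
  linarith

theorem exp_lt_two {x : ℝ} (hx : x < Real.log 2) : Real.exp x < 2 := by
  have := Real.exp_lt_exp.mpr hx
  rwa [Real.exp_log two_pos] at this

theorem cos_crossAngle {x : ℝ} (hx : x < Real.log 2) :
    Real.cos (crossAngle x) = -(Real.exp x) / 2 := by
  have h1 := exp_lt_two hx
  have h2 := Real.exp_pos x
  exact Real.cos_arccos (by linarith) (by linarith)

theorem norm_exp_add_one_sq (u : ℂ) : ‖Complex.exp u + 1‖ ^ 2 =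
    1 + Real.exp u.re * (Real.exp u.re + 2 * Real.cos u.im) := by
  rw [← Complex.normSq_eq_norm_sq, Complex.normSq_apply]
  simp only [Complex.add_re, Complex.add_im, Complex.exp_re, Complex.exp_im, Complex.one_re,
    Complex.one_im]
  linear_combination (Real.exp u.re) ^ 2 * Real.sin_sq_add_cos_sq u.im

theorem one_lt_norm_exp_add_one {u : ℂ} (hx : u.re < Real.log 2)
    (h1 : u.im < crossAngle u.re) (h2 : -crossAngle u.re < u.im) :
    1 < ‖Complex.exp u + 1‖ := by
  have h3 : Real.cos (crossAngle u.re) < Real.cos u.im := by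
    rw [← Real.cos_abs u.im]
    exact Real.cos_lt_cos_of_nonneg_of_le_pi (abs_nonneg _) (crossAngle_le_pi _)
      (abs_lt.mpr ⟨h2, h1⟩)
  rw [cos_crossAngle hx] at h3
  have h4 := norm_exp_add_one_sq u
  have h5 : 0 < Real.exp u.re * (Real.exp u.re + 2 * Real.cos u.im) :=
    mul_pos (Real.exp_pos _) (by linarith)
  nlinarith [norm_nonneg (Complex.exp u + 1)]

theorem norm_exp_add_one_lt_one {u : ℂ} (hx : u.re < Real.log 2)
    (h1 : crossAngle u.re < u.im) (h2 : u.im < 2 * Real.pi - crossAngle u.re) :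
    ‖Complex.exp u + 1‖ < 1 := by
  have h3 : Real.cos u.im < Real.cos (crossAngle u.re) := by
    rcases le_total u.im Real.pi with h | h
    · exact Real.cos_lt_cos_of_nonneg_of_le_pi (crossAngle_nonneg _) h h1
    · rw [← Real.cos_two_pi_sub u.im]
      exact Real.cos_lt_cos_of_nonneg_of_le_pi (crossAngle_nonneg _) (by linarith) (by linarith)
  rw [cos_crossAngle hx] at h3
  have h4 := norm_exp_add_one_sq u
  have h5 : Real.exp u.re * (Real.exp u.re + 2 * Real.cos u.im) < 0 :=
    mul_neg_of_pos_of_neg (Real.exp_pos _) (by linarith)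
  nlinarith [norm_nonneg (Complex.exp u + 1)]

/-- Uniform bounds for the data of the perturbation on the annulus `|log |w| - x₀| < δ`: there
`crossAngle` is `L`-Lipschitz and stays `d` below `π`, and the inner field `q` in logarithmic
coordinates is entire and bounded by `C` on a disc large enough to hold one turn of every orbit:
the crossing points lie within `8` of its centre, an inner arc lasts at most `11`, and the radius
`30` leaves room to solve the inner equation for that long. -/
structure AnnulusBounds (a : ℝ) (q : ℂ → ℂ) (x₀ δ L C d : ℝ) : Prop where
  delta_pos : 0 < δ
  delta_le : δ ≤ 1
  lt_log_two : ∀ x, |x - x₀| < δ → x < Real.log 2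
  lip_nonneg : 0 ≤ L
  lip : ∀ x y, |x - x₀| < δ → |y - x₀| < δ → |crossAngle x - crossAngle y| ≤ L * |x - y|
  gap_pos : 0 < d
  gap : ∀ x, |x - x₀| < δ → crossAngle x ≤ Real.pi - d
  abs_le : |a| ≤ C
  bound : ∀ u ∈ Metric.ball (x₀ : ℂ) 30, ‖q u‖ ≤ C
  differentiable : Differentiable ℂ q

/-- A size of `ε` for which, in the annulus of `AnnulusBounds`, the perturbation is dominated by
the rotation: `lip` makes the crossings transversal, `gap` makes the time spent in the inner zone
positive, and `drift` keeps an orbit in the annulus during one turn, which lasts less than `20`. -/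
structure SmallParam (ε δ L C d : ℝ) : Prop where
  ne_zero : ε ≠ 0
  lip : 2 * (|ε| * C) * (1 + L) ≤ 1 / 4
  gap : 16 * (|ε| * C) ≤ d
  drift : 40 * (|ε| * C) ≤ δ

/-- A Filippov orbit in the annulus `|log |w| - x₀| < δ`, `w = z - 1`, in the logarithmic
coordinate `u = log w` (on the universal cover): the velocity is within `|ε| C` of `-i`, it is
`-i + ε a` outside the disc `|z| ≤ 1` and `-i + ε q(u)` inside. -/
structure IsLogOrbit (a : ℝ) (q : ℂ → ℂ) (x₀ δ C ε : ℝ) (u : ℝ → ℂ) : Prop where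
  rot : ∀ s t, ‖u t - u s + ((t - s : ℝ) : ℂ) * Complex.I‖ ≤ |ε| * C * |t - s|
  mem : ∀ t, |(u t).re - x₀| < δ
  outer : ∀ᵐ t : ℝ, 1 < ‖Complex.exp (u t) + 1‖ → HasDerivAt u (-Complex.I + ε * a) t
  inner : ∀ᵐ t : ℝ, ‖Complex.exp (u t) + 1‖ < 1 → HasDerivAt u (-Complex.I + ε * q (u t)) t

section
variable {a : ℝ} {q : ℂ → ℂ} {x₀ δ L C d ε : ℝ}

theorem AnnulusBounds.C_nonneg (hB : AnnulusBounds a q x₀ δ L C d) : 0 ≤ C :=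
  (abs_nonneg _).trans hB.abs_le

theorem AnnulusBounds.eta_nonneg (hB : AnnulusBounds a q x₀ δ L C d) (ε : ℝ) : 0 ≤ |ε| * C :=
  mul_nonneg (abs_nonneg _) hB.C_nonneg

theorem SmallParam.eta_le (hB : AnnulusBounds a q x₀ δ L C d) (hε : SmallParam ε δ L C d) :
    |ε| * C ≤ 1 / 8 := by
  have h1 := hε.lip
  nlinarith [mul_nonneg (hB.eta_nonneg ε) hB.lip_nonneg]

/-- Both angular distances to the crossing curves decrease at a definite rate along a motion of
nearly constant velocity `-i`. -/
theorem angle_sub_crossAngle_le (hB : AnnulusBounds a q x₀ δ L C d) (hε : SmallParam ε δ L C d)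
    {u v : ℂ} {τ : ℝ} (hτ : 0 ≤ τ) (hu : |u.re - x₀| < δ) (hv : |v.re - x₀| < δ)
    (h : ‖v - u + τ * Complex.I‖ ≤ |ε| * C * τ) :
    v.im - crossAngle v.re ≤ u.im - crossAngle u.re - τ / 2 ∧
      v.im + crossAngle v.re ≤ u.im + crossAngle u.re - τ / 2 := by
  have h1 : |v.re - u.re| ≤ |ε| * C * τ := by
    have := (Complex.abs_re_le_norm _).trans h
    simpa using this
  have h2 : |v.im - u.im + τ| ≤ |ε| * C * τ := by
    have := (Complex.abs_im_le_norm _).trans h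
    simpa using this
  have h3 := hB.lip _ _ hv hu
  have h4 : L * |v.re - u.re| ≤ L * (|ε| * C * τ) := mul_le_mul_of_nonneg_left h1 hB.lip_nonneg
  have h5 : 2 * (|ε| * C) * (1 + L) * τ ≤ 1 / 4 * τ := mul_le_mul_of_nonneg_right hε.lip hτ
  have h6 := abs_le.mp h2
  have h7 := abs_le.mp (h3.trans h4)
  constructor <;> nlinarith

variable {u : ℝ → ℂ}

theorem IsLogOrbit.rot_of_le (hu : IsLogOrbit a q x₀ δ C ε u) {s t : ℝ} (h : s ≤ t) :
    ‖u t - u s + ((t - s : ℝ) : ℂ) * Complex.I‖ ≤ |ε| * C * (t - s) := by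
  have := hu.rot s t
  rwa [abs_of_nonneg (sub_nonneg.mpr h)] at this

theorem IsLogOrbit.lipschitz (hu : IsLogOrbit a q x₀ δ C ε u) :
    ∃ K : NNReal, LipschitzWith K u := by
  refine ⟨Real.toNNReal (|ε| * C + 1), LipschitzWith.of_dist_le_mul fun t s => ?_⟩
  have hη : 0 ≤ |ε| * C := by
    have := (norm_nonneg _).trans (hu.rot 0 1)
    simpa using this
  rw [Real.coe_toNNReal _ (by linarith), dist_eq_norm, Real.dist_eq]
  calc ‖u t - u s‖ = ‖(u t - u s + ((t - s : ℝ) : ℂ) * Complex.I) -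
        ((t - s : ℝ) : ℂ) * Complex.I‖ := by rw [add_sub_cancel_right]
    _ ≤ |ε| * C * |t - s| + |t - s| := by
        refine (norm_sub_le _ _).trans (add_le_add (hu.rot s t) ?_)
        rw [norm_mul, Complex.norm_real]; simp
    _ = (|ε| * C + 1) * |t - s| := by ring

theorem IsLogOrbit.strictAnti_sub (hB : AnnulusBounds a q x₀ δ L C d)
    (hε : SmallParam ε δ L C d) (hu : IsLogOrbit a q x₀ δ C ε u) :
    StrictAnti fun t => (u t).im - crossAngle (u t).re := by
  intro s t hst
  have := (angle_sub_crossAngle_le hB hε (sub_nonneg.mpr hst.le) (hu.mem s) (hu.mem t)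
    (hu.rot_of_le hst.le)).1
  simp only
  linarith

theorem IsLogOrbit.strictAnti_add (hB : AnnulusBounds a q x₀ δ L C d)
    (hε : SmallParam ε δ L C d) (hu : IsLogOrbit a q x₀ δ C ε u) :
    StrictAnti fun t => (u t).im + crossAngle (u t).re := by
  intro s t hst
  have := (angle_sub_crossAngle_le hB hε (sub_nonneg.mpr hst.le) (hu.mem s) (hu.mem t)
    (hu.rot_of_le hst.le)).2
  simp only
  linarith

/-- A continuous function decreasing at rate at least `1/2` is onto. -/
theorem exists_eq_of_decreasing {c : ℝ → ℝ} (hc : Continuous c)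
    (h : ∀ s t, s ≤ t → c t ≤ c s - (t - s) / 2) (v : ℝ) : ∃ t, c t = v := by
  have h1 : c (2 * |c 0 - v|) ≤ v := by
    have := h 0 (2 * |c 0 - v|) (by positivity)
    linarith [le_abs_self (c 0 - v)]
  have h2 : v ≤ c (-(2 * |c 0 - v|)) := by
    have := h (-(2 * |c 0 - v|)) 0 (by linarith [abs_nonneg (c 0 - v)])
    linarith [neg_abs_le (c 0 - v)]
  exact mem_range_of_exists_le_of_exists_ge hc ⟨_, h1⟩ ⟨_, h2⟩

theorem continuous_crossAngle : Continuous crossAngle := by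
  unfold crossAngle
  exact Real.continuous_arccos.comp (by fun_prop)

theorem IsLogOrbit.exists_upper (hB : AnnulusBounds a q x₀ δ L C d)
    (hε : SmallParam ε δ L C d) (hu : IsLogOrbit a q x₀ δ C ε u) (v : ℝ) :
    ∃ t, (u t).im - crossAngle (u t).re = v := by
  obtain ⟨K, hK⟩ := hu.lipschitz
  have hc := hK.continuous
  have := continuous_crossAngle
  exact exists_eq_of_decreasing (c := fun t => (u t).im - crossAngle (u t).re) (by fun_prop)
    (fun s t hst => (angle_sub_crossAngle_le hB hε (sub_nonneg.mpr hst) (hu.mem s) (hu.mem t)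
      (hu.rot_of_le hst)).1) v

theorem IsLogOrbit.exists_lower (hB : AnnulusBounds a q x₀ δ L C d)
    (hε : SmallParam ε δ L C d) (hu : IsLogOrbit a q x₀ δ C ε u) (v : ℝ) :
    ∃ t, (u t).im + crossAngle (u t).re = v := by
  obtain ⟨K, hK⟩ := hu.lipschitz
  have hc := hK.continuous
  have := continuous_crossAngle
  exact exists_eq_of_decreasing (c := fun t => (u t).im + crossAngle (u t).re) (by fun_prop)
    (fun s t hst => (angle_sub_crossAngle_le hB hε (sub_nonneg.mpr hst) (hu.mem s) (hu.mem t)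
      (hu.rot_of_le hst)).2) v

/-- Every argument is taken by a logarithmic orbit. -/
theorem IsLogOrbit.exists_im_eq (hB : AnnulusBounds a q x₀ δ L C d)
    (hε : SmallParam ε δ L C d) (hu : IsLogOrbit a q x₀ δ C ε u) (v : ℝ) :
    ∃ t, (u t).im = v := by
  obtain ⟨K, hK⟩ := hu.lipschitz
  have hc := hK.continuous
  refine exists_eq_of_decreasing (c := fun t => (u t).im) (by fun_prop) (fun s t hst => ?_) v
  have h1 := angle_sub_crossAngle_le hB hε (sub_nonneg.mpr hst) (hu.mem s) (hu.mem t)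
      (hu.rot_of_le hst)
  linarith [h1.1, h1.2]

/-- The field in logarithmic coordinates is invariant under the deck transformations, so shifted
orbits are orbits. -/
theorem IsLogOrbit.shift (hq : ∀ v, q (v + 2 * Real.pi * Complex.I) = q v)
    (hu : IsLogOrbit a q x₀ δ C ε u) (k : ℤ) :
    IsLogOrbit a q x₀ δ C ε (fun t => u t + k * (2 * Real.pi * Complex.I)) := by
  have hq' : ∀ v, q (v + k * (2 * Real.pi * Complex.I)) = q v := by
    have hp : Function.Periodic q (2 * Real.pi * Complex.I) := hq
    intro v
    exact hp.int_mul k v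
  have hexp : ∀ v, Complex.exp (v + k * (2 * Real.pi * Complex.I)) = Complex.exp v := by
    intro v
    rw [Complex.exp_add, Complex.exp_int_mul_two_pi_mul_I, mul_one]
  refine ⟨fun s t => ?_, fun t => ?_, ?_, ?_⟩
  · simpa using hu.rot s t
  · have := hu.mem t
    simpa using this
  · filter_upwards [hu.outer] with t ht h
    rw [hexp] at h
    exact (ht h).add_const _
  · filter_upwards [hu.inner] with t ht h
    rw [hexp] at h
    rw [hq']
    exact (ht h).add_const _

end

/-! ### The complex time function of the inner field -/

/-- `S` is a primitive, on the disc of `AnnulusBounds`, of `q / (1 + i ε q)`. Up to the factor `ε`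
this is the perturbation term in `1 / (-i + ε q) = i + ε q / (1 + i ε q)`. -/
def IsTimePrimitive (q : ℂ → ℂ) (x₀ ε : ℝ) (S : ℂ → ℂ) : Prop :=
  ∀ u ∈ Metric.ball (x₀ : ℂ) 30, HasDerivAt S (q u / (1 + Complex.I * ε * q u)) u

/-- The complex time function of `u' = -i + ε q(u)`: a primitive of the reciprocal of the field.
Along solutions it increases at unit speed, so its imaginary part is a first integral. -/
noncomputable def flowTime (ε : ℝ) (S : ℂ → ℂ) (u : ℂ) : ℂ := Complex.I * u + ε * S u

section
variable {a : ℝ} {q : ℂ → ℂ} {x₀ δ L C d ε : ℝ} {S : ℂ → ℂ}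

theorem norm_eps_mul_le (hB : AnnulusBounds a q x₀ δ L C d) {u : ℂ}
    (hu : u ∈ Metric.ball (x₀ : ℂ) 30) : ‖(ε : ℂ) * q u‖ ≤ |ε| * C := by
  rw [norm_mul, Complex.norm_real, Real.norm_eq_abs]
  exact mul_le_mul_of_nonneg_left (hB.bound u hu) (abs_nonneg _)

theorem half_le_norm_one_add (hB : AnnulusBounds a q x₀ δ L C d) (hε : SmallParam ε δ L C d)
    {u : ℂ} (hu : u ∈ Metric.ball (x₀ : ℂ) 30) : 1 / 2 ≤ ‖1 + Complex.I * ε * q u‖ := by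
  have h1 := norm_eps_mul_le (ε := ε) hB hu
  have h2 := hε.eta_le hB
  have h3 : ‖(1 : ℂ)‖ ≤ ‖1 + Complex.I * ε * q u‖ + ‖Complex.I * ε * q u‖ := by
    simpa using norm_sub_le (1 + Complex.I * ε * q u) (Complex.I * ε * q u)
  rw [norm_one, mul_assoc, norm_mul Complex.I, Complex.norm_I, one_mul] at h3
  rw [mul_assoc]
  linarith

theorem one_add_ne_zero (hB : AnnulusBounds a q x₀ δ L C d) (hε : SmallParam ε δ L C d)
    {u : ℂ} (hu : u ∈ Metric.ball (x₀ : ℂ) 30) : 1 + Complex.I * ε * q u ≠ 0 := by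
  have := half_le_norm_one_add hB hε hu
  intro h
  rw [h, norm_zero] at this
  norm_num at this

theorem exists_isTimePrimitive (hB : AnnulusBounds a q x₀ δ L C d) (hε : SmallParam ε δ L C d) :
    ∃ S, IsTimePrimitive q x₀ ε S := by
  have h : DifferentiableOn ℂ (fun u => q u / (1 + Complex.I * ε * q u))
      (Metric.ball (x₀ : ℂ) 30) := by
    intro u hu
    have h1 := one_add_ne_zero hB hε hu
    have h2 := hB.differentiable u
    exact (DifferentiableAt.div h2 (by fun_prop) h1).differentiableWithinAt
  obtain ⟨S, hS⟩ := h.isExactOn_ball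
  exact ⟨S, hS⟩

theorem hasDerivAt_flowTime (hB : AnnulusBounds a q x₀ δ L C d) (hε : SmallParam ε δ L C d)
    (hS : IsTimePrimitive q x₀ ε S) {u : ℂ} (hu : u ∈ Metric.ball (x₀ : ℂ) 30) :
    HasDerivAt (flowTime ε S) (-Complex.I + ε * q u)⁻¹ u := by
  have h1 := one_add_ne_zero hB hε hu
  have h2 : -Complex.I + ε * q u = -Complex.I * (1 + Complex.I * ε * q u) := by
    linear_combination ε * q u * Complex.I_sq
  convert! ((hasDerivAt_id u).const_mul Complex.I).add ((hS u hu).const_mul (ε : ℂ)) using 1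
  rw [h2, mul_inv, inv_neg, Complex.inv_I]
  field_simp
  linear_combination -ε * q u * Complex.I_sq

/-- The time function is a small Lipschitz perturbation of multiplication by `i`. -/
theorem norm_flowTime_sub_le (hB : AnnulusBounds a q x₀ δ L C d) (hε : SmallParam ε δ L C d)
    (hS : IsTimePrimitive q x₀ ε S) {u v : ℂ} (hu : u ∈ Metric.ball (x₀ : ℂ) 30)
    (hv : v ∈ Metric.ball (x₀ : ℂ) 30) :
    ‖flowTime ε S v - flowTime ε S u - Complex.I * (v - u)‖ ≤ 2 * (|ε| * C) * ‖v - u‖ := by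
  have h := (convex_ball (x₀ : ℂ) 30).norm_image_sub_le_of_norm_hasDerivWithin_le
    (f := fun w => (ε : ℂ) * S w) (f' := fun w => (ε : ℂ) * (q w / (1 + Complex.I * ε * q w)))
    (C := 2 * (|ε| * C))
    (fun w hw => ((hS w hw).const_mul (ε : ℂ)).hasDerivWithinAt) (fun w hw => by
      have h1 := half_le_norm_one_add hB hε hw
      have h2 := norm_eps_mul_le (ε := ε) hB hw
      rw [← mul_div_assoc, norm_div, div_le_iff₀ (by linarith)]
      nlinarith [hB.eta_nonneg ε]) hu hv
  have heq : flowTime ε S v - flowTime ε S u - Complex.I * (v - u) = ε * S v - ε * S u := by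
    simp only [flowTime]
    ring
  rw [heq]
  exact h

theorem norm_flowTime_sub_le' (hB : AnnulusBounds a q x₀ δ L C d) (hε : SmallParam ε δ L C d)
    (hS : IsTimePrimitive q x₀ ε S) {u v : ℂ} (hu : u ∈ Metric.ball (x₀ : ℂ) 30)
    (hv : v ∈ Metric.ball (x₀ : ℂ) 30) :
    ‖flowTime ε S v - flowTime ε S u‖ ≤ 5 / 4 * ‖v - u‖ := by
  have h1 := norm_flowTime_sub_le hB hε hS hu hv
  have h2 := hε.eta_le hB
  have h3 := norm_le_norm_add_norm_sub' (flowTime ε S v - flowTime ε S u) (Complex.I * (v - u))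
  rw [norm_mul, Complex.norm_I, one_mul] at h3
  nlinarith [norm_nonneg (v - u)]

theorem injOn_flowTime (hB : AnnulusBounds a q x₀ δ L C d) (hε : SmallParam ε δ L C d)
    (hS : IsTimePrimitive q x₀ ε S) : Set.InjOn (flowTime ε S) (Metric.ball (x₀ : ℂ) 30) := by
  intro u hu v hv huv
  have h1 := norm_flowTime_sub_le hB hε hS hu hv
  have h2 := hε.eta_le hB
  rw [huv, sub_self, zero_sub, norm_neg, norm_mul, Complex.norm_I, one_mul] at h1
  have h3 : ‖v - u‖ ≤ 0 := by nlinarith [norm_nonneg (v - u)]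
  exact (sub_eq_zero.mp (norm_le_zero_iff.mp h3)).symm

theorem norm_upperCrossing_sub_le (hB : AnnulusBounds a q x₀ δ L C d) {x : ℝ}
    (hx : |x - x₀| < δ) : ‖upperCrossing x - x₀‖ ≤ 8 := by
  refine (Complex.norm_le_abs_re_add_abs_im _).trans ?_
  simp only [upperCrossing, Complex.sub_re, Complex.sub_im, Complex.ofReal_re, Complex.ofReal_im,
    sub_zero, abs_of_nonneg (crossAngle_nonneg x)]
  linarith [crossAngle_le_pi x, Real.pi_le_four, hB.delta_le]

theorem norm_lowerCrossing_sub_le (hB : AnnulusBounds a q x₀ δ L C d) {y : ℝ}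
    (hy : |y - x₀| < δ) : ‖lowerCrossing y - x₀‖ ≤ 8 := by
  have h1 : 0 ≤ 2 * Real.pi - crossAngle y := by linarith [crossAngle_le_pi y, Real.pi_pos]
  refine (Complex.norm_le_abs_re_add_abs_im _).trans ?_
  simp only [lowerCrossing, Complex.sub_re, Complex.sub_im, Complex.ofReal_re, Complex.ofReal_im,
    sub_zero, abs_of_nonneg h1]
  linarith [crossAngle_nonneg y, Real.pi_lt_d2, hB.delta_le]

theorem upperCrossing_mem (hB : AnnulusBounds a q x₀ δ L C d) {x : ℝ}
    (hx : |x - x₀| < δ) : upperCrossing x ∈ Metric.ball (x₀ : ℂ) 30 := by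
  rw [mem_ball_iff_norm]
  linarith [norm_upperCrossing_sub_le hB hx]

theorem lowerCrossing_mem (hB : AnnulusBounds a q x₀ δ L C d) {y : ℝ}
    (hy : |y - x₀| < δ) : lowerCrossing y ∈ Metric.ball (x₀ : ℂ) 30 := by
  rw [mem_ball_iff_norm]
  linarith [norm_lowerCrossing_sub_le hB hy]

theorem norm_upperCrossing_sub (hB : AnnulusBounds a q x₀ δ L C d) {x x' : ℝ}
    (hx : |x - x₀| < δ) (hx' : |x' - x₀| < δ) :
    ‖upperCrossing x' - upperCrossing x‖ ≤ (1 + L) * |x' - x| := by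
  refine (Complex.norm_le_abs_re_add_abs_im _).trans ?_
  have := hB.lip _ _ hx' hx
  simp only [upperCrossing, Complex.sub_re, Complex.sub_im]
  linarith

theorem norm_lowerCrossing_sub (hB : AnnulusBounds a q x₀ δ L C d) {x x' : ℝ}
    (hx : |x - x₀| < δ) (hx' : |x' - x₀| < δ) :
    ‖lowerCrossing x' - lowerCrossing x‖ ≤ (1 + L) * |x' - x| := by
  refine (Complex.norm_le_abs_re_add_abs_im _).trans ?_
  have := hB.lip _ _ hx' hx
  simp only [lowerCrossing, Complex.sub_re, Complex.sub_im, sub_sub_sub_cancel_left]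
  rw [abs_sub_comm (crossAngle x)]
  linarith

theorem flowTime_im_lt (hB : AnnulusBounds a q x₀ δ L C d) (hε : SmallParam ε δ L C d)
    (hS : IsTimePrimitive q x₀ ε S) {u v : ℂ} (hu : u ∈ Metric.ball (x₀ : ℂ) 30)
    (hv : v ∈ Metric.ball (x₀ : ℂ) 30) (hlt : u.re < v.re)
    (hn : ‖v - u‖ ≤ (1 + L) * |v.re - u.re|) :
    (flowTime ε S u).im < (flowTime ε S v).im := by
  have h1 := (Complex.abs_im_le_norm _).trans (norm_flowTime_sub_le hB hε hS hu hv)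
  simp only [Complex.sub_im, Complex.mul_im, Complex.I_re, Complex.I_im, Complex.sub_re, zero_mul,
    one_mul, zero_add] at h1
  rw [abs_of_pos (sub_pos.mpr hlt)] at hn
  have h2 : 2 * (|ε| * C) * ‖v - u‖ ≤ 2 * (|ε| * C) * ((1 + L) * (v.re - u.re)) :=
    mul_le_mul_of_nonneg_left hn (by linarith [hB.eta_nonneg ε])
  have h3 : 2 * (|ε| * C) * (1 + L) * (v.re - u.re) ≤ 1 / 4 * (v.re - u.re) :=
    mul_le_mul_of_nonneg_right hε.lip (by linarith)
  have h4 := (abs_le.mp h1).1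
  nlinarith

theorem flowTime_upperCrossing_im_lt (hB : AnnulusBounds a q x₀ δ L C d)
    (hε : SmallParam ε δ L C d) (hS : IsTimePrimitive q x₀ ε S) {x x' : ℝ}
    (hx : |x - x₀| < δ) (hx' : |x' - x₀| < δ) (h : x < x') :
    (flowTime ε S (upperCrossing x)).im < (flowTime ε S (upperCrossing x')).im :=
  flowTime_im_lt hB hε hS (upperCrossing_mem hB hx) (upperCrossing_mem hB hx') h
    (norm_upperCrossing_sub hB hx hx')

theorem flowTime_lowerCrossing_im_lt (hB : AnnulusBounds a q x₀ δ L C d)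
    (hε : SmallParam ε δ L C d) (hS : IsTimePrimitive q x₀ ε S) {x x' : ℝ}
    (hx : |x - x₀| < δ) (hx' : |x' - x₀| < δ) (h : x < x') :
    (flowTime ε S (lowerCrossing x)).im < (flowTime ε S (lowerCrossing x')).im :=
  flowTime_im_lt hB hε hS (lowerCrossing_mem hB hx) (lowerCrossing_mem hB hx') h
    (norm_lowerCrossing_sub hB hx hx')

/-- The time spent in the inner zone between the two crossings. -/
noncomputable def innerTime (ε : ℝ) (S : ℂ → ℂ) (x y : ℝ) : ℝ :=
  (flowTime ε S (upperCrossing x) - flowTime ε S (lowerCrossing y)).re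

theorem innerTime_pos (hB : AnnulusBounds a q x₀ δ L C d) (hε : SmallParam ε δ L C d)
    (hS : IsTimePrimitive q x₀ ε S) {x y : ℝ} (hx : |x - x₀| < δ) (hy : |y - x₀| < δ) :
    0 < innerTime ε S x y := by
  have h1 := (Complex.abs_re_le_norm _).trans
    (norm_flowTime_sub_le hB hε hS (lowerCrossing_mem hB hy) (upperCrossing_mem hB hx))
  rw [Complex.sub_re, ← innerTime] at h1
  simp only [Complex.mul_re, Complex.I_re, Complex.I_im, Complex.sub_im, zero_mul, one_mul,
    zero_sub] at h1
  have h2 : ‖upperCrossing x - lowerCrossing y‖ ≤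
      2 + (2 * Real.pi - crossAngle y - crossAngle x) := by
    refine (Complex.norm_le_abs_re_add_abs_im _).trans (add_le_add ?_ ?_)
    · simp only [upperCrossing, lowerCrossing, Complex.sub_re]
      have := abs_sub_le x x₀ y
      rw [abs_sub_comm x₀ y] at this
      linarith [hB.delta_le]
    · simp only [upperCrossing, lowerCrossing, Complex.sub_im]
      rw [abs_sub_comm, abs_of_nonneg]
      linarith [crossAngle_le_pi x, crossAngle_le_pi y]
  have h3 := hB.gap x hx
  have h4 := hB.gap y hy
  have h5 := hε.gap
  have h6 := hε.eta_le hB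
  have h7 := (abs_le.mp h1).1
  have h8 := hB.gap_pos
  have h9 : 2 * (|ε| * C) * ‖upperCrossing x - lowerCrossing y‖ ≤
      2 * (|ε| * C) * (2 + (2 * Real.pi - crossAngle y - crossAngle x)) :=
    mul_le_mul_of_nonneg_left h2 (by linarith [hB.eta_nonneg ε])
  simp only [upperCrossing, lowerCrossing] at h7 h9
  nlinarith

theorem innerTime_le (hB : AnnulusBounds a q x₀ δ L C d) (hε : SmallParam ε δ L C d)
    (hS : IsTimePrimitive q x₀ ε S) {x y : ℝ} (hx : |x - x₀| < δ) (hy : |y - x₀| < δ) :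
    innerTime ε S x y ≤ 11 := by
  have h1 := (le_abs_self _).trans ((Complex.abs_re_le_norm _).trans
    (norm_flowTime_sub_le' hB hε hS (lowerCrossing_mem hB hy) (upperCrossing_mem hB hx)))
  have h2 : ‖upperCrossing x - lowerCrossing y‖ ≤ 2 + 2 * Real.pi := by
    refine (Complex.norm_le_abs_re_add_abs_im _).trans (add_le_add ?_ ?_)
    · simp only [upperCrossing, lowerCrossing, Complex.sub_re]
      have := abs_sub_le x x₀ y
      rw [abs_sub_comm x₀ y] at this
      linarith [hB.delta_le]
    · simp only [upperCrossing, lowerCrossing, Complex.sub_im]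
      rw [abs_sub_comm, abs_of_nonneg] <;>
      linarith [crossAngle_le_pi x, crossAngle_le_pi y, crossAngle_nonneg x, crossAngle_nonneg y]
  rw [← innerTime] at h1
  linarith [Real.pi_lt_d2]

/-- Inverting the time function solves `u' = -i + ε q(u)`. -/
theorem exists_inner_solution (hB : AnnulusBounds a q x₀ δ L C d) (hε : SmallParam ε δ L C d)
    (hS : IsTimePrimitive q x₀ ε S) {A : ℂ} (hA : ‖A - x₀‖ ≤ 8) :
    ∃ v : ℝ → ℂ, ∀ τ ∈ Set.Icc (0 : ℝ) 11, v τ ∈ Metric.ball (x₀ : ℂ) 30 ∧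
      flowTime ε S (v τ) = flowTime ε S A + τ ∧ HasDerivAt v (-Complex.I + ε * q (v τ)) τ := by
  -- `-i T` approximates the identity, hence maps the ball of radius `15` about `A` onto a
  -- neighbourhood of the ball of radius `(1 - 1/4) 15 > 11` about `-i T(A)`.
  set f : ℂ → ℂ := fun u => -Complex.I * flowTime ε S u with hf
  have hη := hε.eta_le hB
  have happ : ApproximatesLinearOn f
      ((ContinuousLinearEquiv.refl ℂ ℂ : ℂ ≃L[ℂ] ℂ) : ℂ →L[ℂ] ℂ)
      (Metric.ball (x₀ : ℂ) 30) (1 / 4) := by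
    intro v hv u hu
    have h1 := norm_flowTime_sub_le hB hε hS hu hv
    have h2 : f v - f u - (v - u) =
        -Complex.I * (flowTime ε S v - flowTime ε S u - Complex.I * (v - u)) := by
      simp only [hf]
      linear_combination -(v - u) * Complex.I_sq
    simp only [ContinuousLinearEquiv.coe_refl, ContinuousLinearMap.coe_id', id_eq]
    rw [h2, norm_mul, norm_neg, Complex.norm_I, one_mul]
    refine h1.trans (mul_le_mul_of_nonneg_right ?_ (norm_nonneg _))
    push_cast
    linarith
  have hN : ‖(((ContinuousLinearEquiv.refl ℂ ℂ : ℂ ≃L[ℂ] ℂ).symm : ℂ ≃L[ℂ] ℂ) :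
      ℂ →L[ℂ] ℂ)‖₊ = 1 := by
    simp
  set e := happ.toOpenPartialHomeomorph f _ (Or.inr (by
    rw [hN, inv_one, ← NNReal.coe_lt_coe]; norm_num)) Metric.isOpen_ball with he
  have hA30 : A ∈ Metric.ball (x₀ : ℂ) 30 := by rw [mem_ball_iff_norm]; linarith
  have hsub : Metric.closedBall (f A) (45 / 4) ⊆ e.target := by
    have h := happ.closedBall_subset_target (f' := ContinuousLinearEquiv.refl ℂ ℂ) (Or.inr (by
      rw [hN, inv_one, ← NNReal.coe_lt_coe]; norm_num)) Metric.isOpen_ball (b := A) (ε := 15)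
      (by norm_num) (by
        intro w hw
        rw [mem_closedBall_iff_norm] at hw
        rw [mem_ball_iff_norm]
        calc ‖w - x₀‖ ≤ ‖w - A‖ + ‖A - x₀‖ := norm_sub_le_norm_sub_add_norm_sub _ _ _
          _ < 30 := by linarith)
    refine (Metric.closedBall_subset_closedBall ?_).trans h
    rw [hN]
    norm_num
  have hmem : ∀ τ ∈ Set.Icc (0 : ℝ) 11, f A + -Complex.I * τ ∈ e.target := by
    intro τ hτ
    refine hsub ?_
    rw [mem_closedBall_iff_norm, add_sub_cancel_left, norm_mul, norm_neg, Complex.norm_I, one_mul,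
      Complex.norm_real, Real.norm_eq_abs, abs_of_nonneg hτ.1]
    linarith [hτ.2]
  refine ⟨fun τ => e.symm (f A + -Complex.I * τ), fun τ hτ => ?_⟩
  have h1 := e.map_target (hmem τ hτ)
  have h2 : f (e.symm (f A + -Complex.I * τ)) = f A + -Complex.I * τ := e.right_inv (hmem τ hτ)
  have h3 : e.symm (f A + -Complex.I * τ) ∈ Metric.ball (x₀ : ℂ) 30 := h1
  refine ⟨h3, ?_, ?_⟩
  · simp only [hf] at h2
    have h4 : -Complex.I * flowTime ε S (e.symm (f A + -Complex.I * τ)) =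
        -Complex.I * (flowTime ε S A + τ) := by rw [h2]; ring
    exact mul_left_cancel₀ (neg_ne_zero.mpr Complex.I_ne_zero) h4
  · have hq1 := one_add_ne_zero hB hε h3
    have hq2 : -Complex.I + ε * q (e.symm (f A + -Complex.I * τ)) ≠ 0 := by
      intro h0
      apply hq1
      linear_combination Complex.I * h0 + Complex.I_sq
    have hder : HasDerivAt e (-Complex.I * (-Complex.I + ε * q (e.symm (f A + -Complex.I * τ)))⁻¹)
        (e.symm (f A + -Complex.I * τ)) :=
      (hasDerivAt_flowTime hB hε hS h3).const_mul _
    have hsymm := e.hasDerivAt_symm (hmem τ hτ)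
      (mul_ne_zero (neg_ne_zero.mpr Complex.I_ne_zero) (inv_ne_zero hq2)) hder
    have hline : HasDerivAt (fun τ : ℝ => f A + -Complex.I * τ) (-Complex.I) τ := by
      simpa using ((Complex.ofRealCLM.hasDerivAt (x := τ)).const_mul (-Complex.I)).const_add (f A)
    convert! hsymm.scomp τ hline using 1
    rw [smul_eq_mul, mul_inv, inv_inv, inv_neg, Complex.inv_I]
    linear_combination (-Complex.I + ε * q (e.symm (f A + -Complex.I * τ))) * Complex.I_sq

end

/-! ### The return map and uniqueness of closed orbits -/

/-- The crossing equations: the outer spiral leads from the upper crossing with `log |w| = x` to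
the lower crossing with `log |w| = y`, and the inner first integral agrees there and at the next
upper crossing, with `log |w| = x'`. -/
def Linked (a ε : ℝ) (S : ℂ → ℂ) (x y x' : ℝ) : Prop :=
  y = x + ε * a * (crossAngle x + crossAngle y) ∧
    (flowTime ε S (upperCrossing x')).im = (flowTime ε S (lowerCrossing y)).im

/-- The closed curve traced, in the variable `w = z - 1`, by the outer spiral from the upper
crossing `x` to the lower crossing `y` followed by the inner solution from `y` back to `x`. -/
def returnCurve (a ε : ℝ) (S : ℂ → ℂ) (x₀ x y : ℝ) : Set ℂ :=
  {w | ∃ τ ∈ Set.Icc (0 : ℝ) (crossAngle x + crossAngle y),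
      w = Complex.exp (upperCrossing x + (-Complex.I + ε * a) * τ)} ∪
    {w | ∃ v ∈ Metric.ball (x₀ : ℂ) 30, ∃ τ ∈ Set.Icc (0 : ℝ) (innerTime ε S x y),
      flowTime ε S v = flowTime ε S (lowerCrossing y) + τ ∧ w = Complex.exp v}

section
variable {a : ℝ} {q : ℂ → ℂ} {x₀ δ L C d ε : ℝ} {S : ℂ → ℂ} {u : ℝ → ℂ}

theorem abs_eps_mul_a_le (hB : AnnulusBounds a q x₀ δ L C d) : |ε * a| ≤ |ε| * C := by
  rw [abs_mul]
  exact mul_le_mul_of_nonneg_left hB.abs_le (abs_nonneg _)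

/-- The return map between upper crossings is strictly increasing. -/
theorem Linked.lt (hB : AnnulusBounds a q x₀ δ L C d) (hε : SmallParam ε δ L C d)
    (hS : IsTimePrimitive q x₀ ε S) {x y x' ξ υ ξ' : ℝ} (h : Linked a ε S x y x')
    (h' : Linked a ε S ξ υ ξ') (hx : |x - x₀| < δ) (hy : |y - x₀| < δ) (hx' : |x' - x₀| < δ)
    (hξ : |ξ - x₀| < δ) (hυ : |υ - x₀| < δ) (hξ' : |ξ' - x₀| < δ) (hlt : x < ξ) : x' < ξ' := by
  have hyυ : y < υ := by
    by_contra! hle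
    have h1 := hB.lip x ξ hx hξ
    have h2 := hB.lip y υ hy hυ
    have h3 : |ε * a * (crossAngle x - crossAngle ξ + (crossAngle y - crossAngle υ))| ≤
        |ε| * C * (L * |x - ξ| + L * |y - υ|) := by
      rw [abs_mul]
      exact mul_le_mul (abs_eps_mul_a_le hB) ((abs_add_le _ _).trans (add_le_add h1 h2))
        (abs_nonneg _) (hB.eta_nonneg ε)
    rw [abs_of_neg (by linarith : x - ξ < 0), abs_of_nonneg (by linarith : 0 ≤ y - υ)] at h3
    have h4 : y - υ - (x - ξ) =
        ε * a * (crossAngle x - crossAngle ξ + (crossAngle y - crossAngle υ)) := by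
      linear_combination h.1 - h'.1
    rw [← h4] at h3
    have h5 : |ε| * C * L ≤ 1 / 8 := by nlinarith [hε.lip, hB.eta_nonneg ε]
    have h6 := (abs_le.mp h3).2
    have h7 : |ε| * C * L * ((ξ - x) + (y - υ)) ≤ 1 / 8 * ((ξ - x) + (y - υ)) :=
      mul_le_mul_of_nonneg_right h5 (by linarith)
    nlinarith
  have h1 := flowTime_lowerCrossing_im_lt hB hε hS hy hυ hyυ
  rw [← h.2, ← h'.2] at h1
  by_contra! hle
  rcases hle.eq_or_lt with h2 | h2
  · rw [h2] at h1; exact lt_irrefl _ h1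
  · exact lt_asymm h1 (flowTime_upperCrossing_im_lt hB hε hS hξ' hx' h2)

/-- Between an upper crossing and the next lower crossing the orbit follows the outer spiral. -/
theorem IsLogOrbit.outer_arc (hB : AnnulusBounds a q x₀ δ L C d) (hε : SmallParam ε δ L C d)
    (hu : IsLogOrbit a q x₀ δ C ε u) {t₀ s₀ : ℝ} (ht₀ : (u t₀).im - crossAngle (u t₀).re = 0)
    (hs₀ : (u s₀).im + crossAngle (u s₀).re = 0) :
    t₀ < s₀ ∧ ∀ t ∈ Set.Icc t₀ s₀, u t = u t₀ + (-Complex.I + ε * a) * ((t - t₀ : ℝ) : ℂ) := by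
  have hanti := hu.strictAnti_sub hB hε
  have hanti' := hu.strictAnti_add hB hε
  have hlt : t₀ < s₀ := by
    refine hanti.lt_iff_gt.mp ?_
    simp only [ht₀]
    linarith [crossAngle_pos (u s₀).re]
  refine ⟨hlt, ?_⟩
  obtain ⟨K, hK⟩ := hu.lipschitz
  have hac : AbsolutelyContinuousOnInterval
      (fun t : ℝ => u t - (-Complex.I + ε * a) * ((t - t₀ : ℝ) : ℂ)) t₀ s₀ := by
    refine (hK.lipschitzOnWith.absolutelyContinuousOnInterval).fun_sub
      (ContDiffOn.absolutelyContinuousOnInterval ?_)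
    have : ContDiff ℝ 1 fun t : ℝ => (-Complex.I + ε * a) * ((t - t₀ : ℝ) : ℂ) :=
      contDiff_const.mul (Complex.ofRealCLM.contDiff.comp (contDiff_id.sub contDiff_const))
    exact this.contDiffOn
  obtain ⟨c, hc⟩ := hac.const_of_ae_hasDerivAt_zero (by
    have hne : ∀ r : ℝ, ∀ᵐ t : ℝ, t ≠ r := fun r => MeasureTheory.Measure.ae_ne _ r
    filter_upwards [hu.outer, hne t₀, hne s₀] with t ht h1 h2 ht'
    rw [Set.uIcc_of_le hlt.le] at ht'
    have h3 : t₀ < t := lt_of_le_of_ne ht'.1 (Ne.symm h1)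
    have h4 : t < s₀ := lt_of_le_of_ne ht'.2 h2
    have h5 := hanti h3
    have h6 := hanti' h4
    simp only [ht₀, hs₀] at h5 h6
    have h7 := ht (one_lt_norm_exp_add_one (hB.lt_log_two _ (hu.mem t)) (by linarith)
      (by linarith))
    have h8 : HasDerivAt (fun t : ℝ => (-Complex.I + ε * a) * ((t - t₀ : ℝ) : ℂ))
        (-Complex.I + ε * a) t := by
      have := ((((hasDerivAt_id t).sub_const t₀).ofReal_comp).const_mul (-Complex.I + ε * a))
      simpa using this
    convert! h7.sub h8 using 1
    rw [sub_self])
  intro t ht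
  rw [Set.uIcc_of_le hlt.le] at hc
  have h1 := hc t ht
  have h2 := hc t₀ (Set.left_mem_Icc.mpr hlt.le)
  rw [← h2] at h1
  simp only [sub_self, Complex.ofReal_zero, mul_zero, sub_zero] at h1
  linear_combination h1

/-- Between a lower crossing and the next upper crossing the time function grows at unit speed. -/
theorem IsLogOrbit.inner_arc (hB : AnnulusBounds a q x₀ δ L C d) (hε : SmallParam ε δ L C d)
    (hq : ∀ v, q (v + 2 * Real.pi * Complex.I) = q v)
    (hS : IsTimePrimitive q x₀ ε S)
    (hu : IsLogOrbit a q x₀ δ C ε u) {s₀ t₁ : ℝ} (hs₀ : (u s₀).im + crossAngle (u s₀).re = 0)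
    (ht₁ : (u t₁).im - crossAngle (u t₁).re = -(2 * Real.pi)) :
    s₀ < t₁ ∧ ∀ t ∈ Set.Icc s₀ t₁, u t + 2 * Real.pi * Complex.I ∈ Metric.ball (x₀ : ℂ) 30 ∧
      flowTime ε S (u t + 2 * Real.pi * Complex.I) =
        flowTime ε S (u s₀ + 2 * Real.pi * Complex.I) + ((t - s₀ : ℝ) : ℂ) := by
  have hanti := hu.strictAnti_sub hB hε
  have hanti' := hu.strictAnti_add hB hε
  have hlt : s₀ < t₁ := by
    refine hanti'.lt_iff_gt.mp ?_
    simp only [hs₀]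
    linarith [hB.gap _ (hu.mem t₁), hB.gap_pos]
  have hmem : ∀ t ∈ Set.Icc s₀ t₁,
      u t + 2 * Real.pi * Complex.I ∈ Metric.ball (x₀ : ℂ) 30 := by
    intro t ht
    have h1 := hanti.antitone ht.2
    have h2 := hanti'.antitone ht.1
    simp only [ht₁, hs₀] at h1 h2
    rw [mem_ball_iff_norm]
    refine (Complex.norm_le_abs_re_add_abs_im _).trans_lt ?_
    have h3 : (u t + 2 * Real.pi * Complex.I - x₀).re = (u t).re - x₀ := by simp
    have h4 : (u t + 2 * Real.pi * Complex.I - x₀).im = (u t).im + 2 * Real.pi := by simp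
    have h5 := crossAngle_nonneg (u t).re
    rw [h3, h4, abs_of_nonneg (by linarith : 0 ≤ (u t).im + 2 * Real.pi)]
    linarith [hu.mem t, hB.delta_le, Real.pi_lt_d2]
  refine ⟨hlt, ?_⟩
  obtain ⟨K, hK⟩ := hu.lipschitz
  have hT : LipschitzOnWith (5 / 4) (flowTime ε S) (Metric.ball (x₀ : ℂ) 30) := by
    refine LipschitzOnWith.of_dist_le_mul fun v hv w hw => ?_
    rw [dist_eq_norm, dist_eq_norm]
    exact (norm_flowTime_sub_le' hB hε hS hw hv).trans_eq (by push_cast; rfl)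
  have hac : AbsolutelyContinuousOnInterval
      (fun t : ℝ => flowTime ε S (u t + 2 * Real.pi * Complex.I) - ((t - s₀ : ℝ) : ℂ)) s₀ t₁ := by
    refine AbsolutelyContinuousOnInterval.fun_sub ?_
      (ContDiffOn.absolutelyContinuousOnInterval ?_)
    · have h1 : LipschitzOnWith (K + 0) (fun t => u t + 2 * Real.pi * Complex.I)
          (Set.uIcc s₀ t₁) :=
        (hK.add (LipschitzWith.const _)).lipschitzOnWith
      refine (hT.comp h1 ?_).absolutelyContinuousOnInterval
      rw [Set.uIcc_of_le hlt.le]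
      exact hmem
    · have : ContDiff ℝ 1 fun t : ℝ => ((t - s₀ : ℝ) : ℂ) :=
        Complex.ofRealCLM.contDiff.comp (contDiff_id.sub contDiff_const)
      exact this.contDiffOn
  obtain ⟨c, hc⟩ := hac.const_of_ae_hasDerivAt_zero (by
    have hne : ∀ r : ℝ, ∀ᵐ t : ℝ, t ≠ r := fun r => MeasureTheory.Measure.ae_ne _ r
    filter_upwards [hu.inner, hne s₀, hne t₁] with t ht h1 h2 ht'
    rw [Set.uIcc_of_le hlt.le] at ht'
    have h3 : s₀ < t := lt_of_le_of_ne ht'.1 (Ne.symm h1)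
    have h4 : t < t₁ := lt_of_le_of_ne ht'.2 h2
    have h5 := hanti' h3
    have h6 := hanti h4
    simp only [ht₁, hs₀] at h5 h6
    have hexp : Complex.exp (u t) = Complex.exp (u t + 2 * Real.pi * Complex.I) := by
      rw [Complex.exp_add, Complex.exp_two_pi_mul_I, mul_one]
    have hre : (u t + 2 * Real.pi * Complex.I).re = (u t).re := by simp
    have him : (u t + 2 * Real.pi * Complex.I).im = (u t).im + 2 * Real.pi := by simp
    have h7 := ht (by
      rw [hexp]
      refine norm_exp_add_one_lt_one ?_ ?_ ?_
      · rw [hre]; exact hB.lt_log_two _ (hu.mem t)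
      · rw [hre, him]; linarith
      · rw [hre, him]; linarith)
    have h8 : HasDerivAt (fun t : ℝ => ((t - s₀ : ℝ) : ℂ)) 1 t := by
      simpa using ((hasDerivAt_id t).sub_const s₀).ofReal_comp
    have h9 := hasDerivAt_flowTime hB hε hS (hmem t ht')
    have h10 := h9.scomp t (h7.add_const (2 * Real.pi * Complex.I))
    convert! h10.sub h8 using 1
    have h11 : -Complex.I + ε * q (u t) ≠ 0 := by
      intro h0
      apply one_add_ne_zero hB hε (hmem t ht')
      rw [hq]
      linear_combination Complex.I * h0 + Complex.I_sq
    rw [hq, smul_eq_mul, mul_inv_cancel₀ h11, sub_self])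
  intro t ht
  rw [Set.uIcc_of_le hlt.le] at hc
  have h1 := hc t ht
  have h2 := hc s₀ (Set.left_mem_Icc.mpr hlt.le)
  rw [← h2] at h1
  simp only [sub_self, Complex.ofReal_zero, sub_zero] at h1
  exact ⟨hmem t ht, by linear_combination h1⟩

theorem eq_upperCrossing {z : ℂ} (h : z.im - crossAngle z.re = 0) : z = upperCrossing z.re :=
  Complex.ext rfl (sub_eq_zero.mp h)

theorem eq_lowerCrossing {z : ℂ} (h : z.im + crossAngle z.re = 0) :
    z + 2 * Real.pi * Complex.I = lowerCrossing z.re := by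
  apply Complex.ext
  · simp [lowerCrossing]
  · simp only [lowerCrossing, Complex.add_im, Complex.mul_im]
    simp
    linarith

theorem eq_upperCrossing' {z : ℂ} (h : z.im - crossAngle z.re = -(2 * Real.pi)) :
    z + 2 * Real.pi * Complex.I = upperCrossing z.re := by
  apply Complex.ext
  · simp [upperCrossing]
  · simp only [upperCrossing, Complex.add_im, Complex.mul_im]
    simp
    linarith

/-- Consecutive crossings satisfy the crossing equations. -/
theorem IsLogOrbit.linked (hB : AnnulusBounds a q x₀ δ L C d) (hε : SmallParam ε δ L C d)
    (hq : ∀ v, q (v + 2 * Real.pi * Complex.I) = q v)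
    (hS : IsTimePrimitive q x₀ ε S)
    (hu : IsLogOrbit a q x₀ δ C ε u) {t₀ s₀ t₁ : ℝ}
    (ht₀ : (u t₀).im - crossAngle (u t₀).re = 0)
    (hs₀ : (u s₀).im + crossAngle (u s₀).re = 0)
    (ht₁ : (u t₁).im - crossAngle (u t₁).re = -(2 * Real.pi)) :
    Linked a ε S (u t₀).re (u s₀).re (u t₁).re := by
  obtain ⟨hlt, h1⟩ := hu.outer_arc hB hε ht₀ hs₀
  obtain ⟨hlt', h2⟩ := hu.inner_arc hB hε hq hS hs₀ ht₁
  constructor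
  · have h3 := h1 s₀ (Set.right_mem_Icc.mpr hlt.le)
    have hre := congrArg Complex.re h3
    have him := congrArg Complex.im h3
    simp at hre him
    have h4 : s₀ - t₀ = crossAngle (u t₀).re + crossAngle (u s₀).re := by linarith
    rw [← h4]
    exact hre
  · have h3 := (h2 t₁ (Set.right_mem_Icc.mpr hlt'.le)).2
    rw [eq_lowerCrossing hs₀, eq_upperCrossing' ht₁] at h3
    rw [h3, Complex.add_im, Complex.ofReal_im, add_zero]

/-- One turn of an orbit which returns to the same upper crossing traces `returnCurve`. -/
theorem IsLogOrbit.image_turn (hB : AnnulusBounds a q x₀ δ L C d) (hε : SmallParam ε δ L C d)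
    (hq : ∀ v, q (v + 2 * Real.pi * Complex.I) = q v)
    (hS : IsTimePrimitive q x₀ ε S)
    (hu : IsLogOrbit a q x₀ δ C ε u) {t₀ s₀ t₁ : ℝ}
    (ht₀ : (u t₀).im - crossAngle (u t₀).re = 0)
    (hs₀ : (u s₀).im + crossAngle (u s₀).re = 0)
    (ht₁ : (u t₁).im - crossAngle (u t₁).re = -(2 * Real.pi))
    (hx : (u t₁).re = (u t₀).re) :
    (fun t => Complex.exp (u t)) '' Set.Icc t₀ t₁ =
      returnCurve a ε S x₀ (u t₀).re (u s₀).re := by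
  obtain ⟨hlt, h1⟩ := hu.outer_arc hB hε ht₀ hs₀
  obtain ⟨hlt', h2⟩ := hu.inner_arc hB hε hq hS hs₀ ht₁
  have hτ₀ : s₀ - t₀ = crossAngle (u t₀).re + crossAngle (u s₀).re := by
    have him := congrArg Complex.im (h1 s₀ (Set.right_mem_Icc.mpr hlt.le))
    simp at him
    linarith
  have hτ₁ : t₁ - s₀ = innerTime ε S (u t₀).re (u s₀).re := by
    have h3 := (h2 t₁ (Set.right_mem_Icc.mpr hlt'.le)).2
    rw [eq_lowerCrossing hs₀, eq_upperCrossing' ht₁, hx] at h3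
    rw [innerTime, h3, add_sub_cancel_left, Complex.ofReal_re]
  have hexp : ∀ t, Complex.exp (u t) = Complex.exp (u t + 2 * Real.pi * Complex.I) := by
    intro t
    rw [Complex.exp_add, Complex.exp_two_pi_mul_I, mul_one]
  ext w
  constructor
  · rintro ⟨t, ht, rfl⟩
    rcases le_total t s₀ with h | h
    · refine Or.inl ⟨t - t₀, ⟨by linarith [ht.1], by linarith⟩, ?_⟩
      simp only
      rw [h1 t ⟨ht.1, h⟩, ← eq_upperCrossing ht₀]
    · obtain ⟨h3, h4⟩ := h2 t ⟨h, ht.2⟩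
      refine Or.inr ⟨_, h3, t - s₀, ⟨by linarith, by linarith [ht.2]⟩, ?_, hexp t⟩
      rw [h4, eq_lowerCrossing hs₀]
  · rintro (⟨τ, hτ, rfl⟩ | ⟨v, hv, τ, hτ, hT, rfl⟩)
    · refine ⟨t₀ + τ, ⟨by linarith [hτ.1], by linarith [hτ.2]⟩, ?_⟩
      simp only
      rw [h1 (t₀ + τ) ⟨by linarith [hτ.1], by linarith [hτ.2]⟩, ← eq_upperCrossing ht₀,
        add_sub_cancel_left]
    · obtain ⟨h3, h4⟩ := h2 (s₀ + τ) ⟨by linarith [hτ.1], by linarith [hτ.2]⟩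
      refine ⟨s₀ + τ, ⟨by linarith [hτ.1], by linarith [hτ.2]⟩, ?_⟩
      simp only
      rw [hexp]
      congr 1
      refine injOn_flowTime hB hε hS h3 hv ?_
      rw [h4, hT, eq_lowerCrossing hs₀, add_sub_cancel_left]

/-- A closed logarithmic orbit makes one turn only: it traces `returnCurve` for a solution of the
crossing equations. -/
theorem IsLogOrbit.range_exp_eq (hB : AnnulusBounds a q x₀ δ L C d)
    (hε : SmallParam ε δ L C d) (hq : ∀ v, q (v + 2 * Real.pi * Complex.I) = q v)
    (hS : IsTimePrimitive q x₀ ε S) (hu : IsLogOrbit a q x₀ δ C ε u) {P : ℝ} (hP : 0 < P)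
    (hper : ∀ t, Complex.exp (u (t + P)) = Complex.exp (u t)) :
    ∃ x y, |x - x₀| < δ ∧ |y - x₀| < δ ∧ Linked a ε S x y x ∧
      Set.range (fun t => Complex.exp (u t)) = returnCurve a ε S x₀ x y := by
  have hanti := hu.strictAnti_sub hB hε
  choose t ht using fun k : ℤ => hu.exists_upper hB hε (-(2 * Real.pi * k))
  choose s hs using fun k : ℤ => hu.exists_lower hB hε (-(2 * Real.pi * k))
  have hsh := fun k : ℤ => hu.shift hq k
  have hre : ∀ (k : ℤ) r, (u r + k * (2 * Real.pi * Complex.I)).re = (u r).re := by simp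
  have him : ∀ (k : ℤ) r,
      (u r + k * (2 * Real.pi * Complex.I)).im = (u r).im + 2 * Real.pi * k := by
    intro k r; simp; ring
  have ht₀ : ∀ k : ℤ, (u (t k) + k * (2 * Real.pi * Complex.I)).im -
      crossAngle (u (t k) + k * (2 * Real.pi * Complex.I)).re = 0 := by
    intro k; rw [hre, him]; linarith [ht k]
  have hs₀ : ∀ k : ℤ, (u (s k) + k * (2 * Real.pi * Complex.I)).im +
      crossAngle (u (s k) + k * (2 * Real.pi * Complex.I)).re = 0 := by
    intro k; rw [hre, him]; linarith [hs k]
  have ht₁ : ∀ k : ℤ, (u (t (k + 1)) + k * (2 * Real.pi * Complex.I)).im -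
      crossAngle (u (t (k + 1)) + k * (2 * Real.pi * Complex.I)).re = -(2 * Real.pi) := by
    intro k
    have := ht (k + 1)
    push_cast at this
    rw [hre, him]; linarith
  -- The deck transformation by `k` brings the crossings number `k` and `k + 1` to the first sheet.
  have hlink : ∀ k : ℤ, Linked a ε S (u (t k)).re (u (s k)).re (u (t (k + 1))).re := by
    intro k
    have := (hsh k).linked hB hε hq hS (ht₀ k) (hs₀ k) (ht₁ k)
    rwa [hre, hre, hre] at this
  -- After one period the orbit is again at an upper crossing, `n ≥ 1` turns later.
  have hret : ∀ k : ℤ, ∃ n : ℕ, (u (t (k + (n + 1 : ℕ)))).re = (u (t k)).re := by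
    intro k
    obtain ⟨m, hm⟩ := Complex.exp_eq_exp_iff_exists_int.mp (hper (t k))
    have h1 : (u (t k + P)).re = (u (t k)).re := by rw [hm, hre]
    have h2 : (u (t k + P)).im = (u (t k)).im + 2 * Real.pi * m := by rw [hm, him]
    have h3 := hanti (lt_add_of_pos_right (t k) hP)
    simp only [h1, h2] at h3
    have hm0 : m < 0 := by
      by_contra! hge
      have : (0 : ℝ) ≤ m := by exact_mod_cast hge
      nlinarith [Real.pi_pos]
    obtain ⟨n, hn⟩ := Int.exists_add_of_le (Int.add_one_le_of_lt hm0)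
    have hmn : -m = (n + 1 : ℕ) := by push_cast; linarith
    refine ⟨n, ?_⟩
    have h4 : t (k + (n + 1 : ℕ)) = t k + P := by
      refine hanti.injective ?_
      rw [ht, h1, h2, ← hmn]
      push_cast
      linarith [ht k]
    rw [h4, h1]
  -- Orbits of an increasing map are monotone, so the periodic sequence of crossings is constant.
  have hx : ∀ k : ℤ, (u (t (k + 1))).re = (u (t k)).re := by
    intro k
    obtain ⟨n, hn⟩ := hret k
    rcases lt_trichotomy (u (t k)).re (u (t (k + 1))).re with h | h | h
    · have hstep : ∀ j : ℕ, (u (t (k + j))).re < (u (t (k + j + 1))).re := by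
        intro j
        induction j with
        | zero => simpa using h
        | succ j ih =>
          have := (hlink _).lt hB hε hS (hlink _) (hu.mem _) (hu.mem _) (hu.mem _) (hu.mem _)
            (hu.mem _) (hu.mem _) ih
          rw [Nat.cast_succ, ← add_assoc]
          exact this
      have hmono : StrictMono fun j : ℕ => (u (t (k + j))).re :=
        strictMono_nat_of_lt_succ fun j => by
          have := hstep j
          rwa [add_assoc, ← Nat.cast_succ] at this
      have := hmono (Nat.succ_pos n)
      simp only [Nat.cast_zero, add_zero] at this
      rw [Nat.succ_eq_add_one, hn] at this
      exact absurd this (lt_irrefl _)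
    · exact h.symm
    · have hstep : ∀ j : ℕ, (u (t (k + j + 1))).re < (u (t (k + j))).re := by
        intro j
        induction j with
        | zero => simpa using h
        | succ j ih =>
          have := (hlink _).lt hB hε hS (hlink _) (hu.mem _) (hu.mem _) (hu.mem _) (hu.mem _)
            (hu.mem _) (hu.mem _) ih
          rw [Nat.cast_succ, ← add_assoc]
          exact this
      have hmono : StrictAnti fun j : ℕ => (u (t (k + j))).re :=
        strictAnti_nat_of_succ_lt fun j => by
          have := hstep j
          rwa [add_assoc, ← Nat.cast_succ] at this
      have := hmono (Nat.succ_pos n)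
      simp only [Nat.cast_zero, add_zero] at this
      rw [Nat.succ_eq_add_one, hn] at this
      exact absurd this (lt_irrefl _)
  have hx0 : ∀ k : ℤ, (u (t k)).re = (u (t 0)).re := by
    intro k
    induction k using Int.induction_on with
    | zero => rfl
    | succ j ih => rw [hx, ih]
    | pred j ih => rw [← ih, ← hx, sub_add_cancel]
  have hy0 : ∀ k : ℤ, (u (s k)).re = (u (s 0)).re := by
    intro k
    have h1 := (hlink k).2
    have h2 := (hlink 0).2
    rw [hx0] at h1 h2
    rw [h1] at h2
    rcases lt_trichotomy (u (s k)).re (u (s 0)).re with h | h | h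
    · exact absurd h2 (flowTime_lowerCrossing_im_lt hB hε hS (hu.mem _) (hu.mem _) h).ne
    · exact h
    · exact absurd h2 (flowTime_lowerCrossing_im_lt hB hε hS (hu.mem _) (hu.mem _) h).ne'
  have himg : ∀ k : ℤ, (fun r => Complex.exp (u r)) '' Set.Icc (t k) (t (k + 1)) =
      returnCurve a ε S x₀ (u (t 0)).re (u (s 0)).re := by
    intro k
    have := (hsh k).image_turn hB hε hq hS (ht₀ k) (hs₀ k) (ht₁ k) (by rw [hre, hre, hx])
    rw [hre, hre, hx0, hy0] at this
    rw [← this]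
    refine Set.image_congr fun r _ => ?_
    rw [Complex.exp_add, Complex.exp_int_mul_two_pi_mul_I, mul_one]
  refine ⟨(u (t 0)).re, (u (s 0)).re, hu.mem _, hu.mem _, ?_, ?_⟩
  · have := hlink 0
    rwa [hx0 (0 + 1)] at this
  · refine Set.Subset.antisymm ?_ ?_
    · rintro _ ⟨r, rfl⟩
      set k : ℤ := ⌊-((u r).im - crossAngle (u r).re) / (2 * Real.pi)⌋ with hk
      rw [← himg k]
      have h2π : (0 : ℝ) < 2 * Real.pi := by positivity
      have h1 := Int.floor_le (-((u r).im - crossAngle (u r).re) / (2 * Real.pi))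
      have h2 := Int.lt_floor_add_one (-((u r).im - crossAngle (u r).re) / (2 * Real.pi))
      rw [← hk, le_div_iff₀ h2π] at h1
      rw [← hk, div_lt_iff₀ h2π] at h2
      refine ⟨r, ⟨?_, ?_⟩, rfl⟩
      · refine hanti.le_iff_ge.mp ?_
        change (u r).im - crossAngle (u r).re ≤ (u (t k)).im - crossAngle (u (t k)).re
        rw [ht k]
        linarith
      · refine hanti.le_iff_ge.mp ?_
        change (u (t (k + 1))).im - crossAngle (u (t (k + 1))).re ≤
          (u r).im - crossAngle (u r).re
        have := ht (k + 1)
        push_cast at this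
        linarith
    · rw [← himg 0]
      exact Set.image_subset_range _ _

end

/-! ### Construction and classification of periodic orbits -/

/-- The annulus `|log |z - 1| - x₀| < δ`. -/
def logAnnulus (x₀ δ : ℝ) : Set ℂ := {z | z ≠ 1 ∧ |Real.log ‖z - 1‖ - x₀| < δ}

/-- The perturbation is `a (z - 1)` in the two outer zones and, in the coordinate
`z = 1 + e^u`, it is `q(u) e^u` in the inner zone. -/
structure HasLogForm (h : Zone → Polynomial ℂ) (a : ℝ) (q : ℂ → ℂ) : Prop where
  minus : h Zone.minus = h Zone.center
  center : ∀ z, (h Zone.center).eval z = a * (z - 1)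
  plus : ∀ u, (h Zone.plus).eval (Complex.exp u + 1) = q u * Complex.exp u

/-- The `P`-periodic extension of a Lipschitz function on `[0, P]` with equal boundary values is
Lipschitz. -/
theorem norm_periodicExtension_sub_le {f : ℝ → ℂ} {P K : ℝ} (hP : 0 < P)
    (hlip : ∀ s ∈ Set.Icc 0 P, ∀ t ∈ Set.Icc 0 P, ‖f t - f s‖ ≤ K * |t - s|)
    (hend : f P = f 0) (s t : ℝ) :
    ‖f (toIcoMod hP 0 t) - f (toIcoMod hP 0 s)‖ ≤ K * |t - s| := by
  have hK : 0 ≤ K := by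
    have := (norm_nonneg _).trans (hlip 0 ⟨le_rfl, hP.le⟩ P ⟨hP.le, le_rfl⟩)
    rw [sub_zero, abs_of_pos hP] at this
    exact nonneg_of_mul_nonneg_left this hP
  wlog hst : s ≤ t generalizing s t
  · rw [norm_sub_rev, abs_sub_comm]
    exact this t s (le_of_not_ge hst)
  have hmem : ∀ r, toIcoMod hP 0 r ∈ Set.Icc 0 P := by
    intro r
    have := toIcoMod_mem_Ico hP 0 r
    rw [zero_add] at this
    exact ⟨this.1, this.2.le⟩
  have hs := toIcoMod_add_toIcoDiv_zsmul hP 0 s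
  have ht := toIcoMod_add_toIcoDiv_zsmul hP 0 t
  have hs' := hmem s
  have ht' := hmem t
  set s' := toIcoMod hP 0 s
  set t' := toIcoMod hP 0 t
  rw [zsmul_eq_mul] at hs ht
  rw [abs_of_nonneg (by linarith : 0 ≤ t - s)]
  rcases lt_trichotomy (toIcoDiv hP 0 t) (toIcoDiv hP 0 s) with h | h | h
  · have h1 : ((toIcoDiv hP 0 t : ℤ) : ℝ) + 1 ≤ (toIcoDiv hP 0 s : ℤ) := by exact_mod_cast h
    have h2 : t' = P ∧ s' = 0 := by
      constructor <;> nlinarith [hs'.1, ht'.2]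
    rw [h2.1, h2.2, hend, sub_self, norm_zero]
    exact mul_nonneg hK (by linarith)
  · have h1 : t - s = t' - s' := by
      rw [h] at ht
      linarith
    have := hlip s' hs' t' ht'
    rwa [← h1, abs_of_nonneg (by linarith)] at this
  · have h1 : ((toIcoDiv hP 0 s : ℤ) : ℝ) + 1 ≤ (toIcoDiv hP 0 t : ℤ) := by exact_mod_cast h
    have h2 : t' + (P - s') ≤ t - s := by nlinarith
    have h3 := hlip 0 ⟨le_rfl, hP.le⟩ t' ht'
    have h4 := hlip s' hs' P ⟨hP.le, le_rfl⟩
    rw [sub_zero, abs_of_nonneg ht'.1] at h3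
    rw [abs_of_nonneg (by linarith [hs'.2])] at h4
    calc ‖f t' - f s'‖ = ‖(f t' - f 0) + (f P - f s')‖ := by rw [hend]; congr 1; ring
      _ ≤ K * t' + K * (P - s') := (norm_add_le _ _).trans (add_le_add h3 h4)
      _ = K * (t' + (P - s')) := by ring
      _ ≤ K * (t - s) := mul_le_mul_of_nonneg_left h2 hK

/-- Derivatives of a periodic extension at the interior points of the period. -/
theorem hasDerivAt_periodicExtension {f : ℝ → ℂ} {f' : ℂ} {P t : ℝ} (hP : 0 < P)
    (ht : 0 < toIcoMod hP 0 t) (hf : HasDerivAt f f' (toIcoMod hP 0 t)) :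
    HasDerivAt (fun r => f (toIcoMod hP 0 r)) f' t := by
  have ht2 := toIcoMod_lt_right hP 0 t
  rw [zero_add] at ht2
  set n := toIcoDiv hP 0 t
  have h0 : toIcoMod hP 0 t = t - n • P := rfl
  have hev : (fun r => f (toIcoMod hP 0 r)) =ᶠ[nhds t] fun r => f (r - n • P) := by
    have hc : ContinuousAt (fun r => r - n • P) t := by fun_prop
    have := hc.preimage_mem_nhds (Ioo_mem_nhds (a := 0) (b := P) (h0 ▸ ht) (h0 ▸ ht2))
    filter_upwards [this] with r hr
    have h1 : toIcoMod hP 0 r = r - n • P := by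
      rw [← toIcoMod_sub_zsmul hP 0 r n, toIcoMod_eq_self]
      exact ⟨hr.1.le, by simpa using hr.2⟩
    rw [h1]
  rw [h0] at hf
  have h2 := hf.comp_sub_const t (n • P)
  exact h2.congr_of_eventuallyEq hev

section
variable {a : ℝ} {q : ℂ → ℂ} {x₀ δ L C d ε : ℝ} {S : ℂ → ℂ} {h : Zone → Polynomial ℂ}

/-- A solution of the crossing equations gives one closed turn in logarithmic coordinates. -/
theorem Linked.exists_closed_turn (hB : AnnulusBounds a q x₀ δ L C d)
    (hε : SmallParam ε δ L C d) (hq : ∀ v, q (v + 2 * Real.pi * Complex.I) = q v)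
    (hS : IsTimePrimitive q x₀ ε S) {x y : ℝ} (hxy : Linked a ε S x y x)
    (hx : |x - x₀| < δ / 2) (hy : |y - x₀| < δ) :
    ∃ (v : ℝ → ℂ) (P τ₀ : ℝ), 0 < τ₀ ∧ τ₀ < P ∧ v 0 = upperCrossing x ∧
      v P = v 0 - 2 * Real.pi * Complex.I ∧ (v τ₀).im = -crossAngle (v τ₀).re ∧
      (∀ s t, 0 ≤ s → s ≤ t → t ≤ P →
        ‖v t - v s + ((t - s : ℝ) : ℂ) * Complex.I‖ ≤ |ε| * C * (t - s)) ∧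
      (∀ t ∈ Set.Icc 0 P, |(v t).re - x₀| < δ) ∧
      ∀ t ∈ Set.Ioo 0 P, t ≠ τ₀ →
        (1 < ‖Complex.exp (v t) + 1‖ ∧ HasDerivAt v (-Complex.I + ε * a) t) ∨
        (‖Complex.exp (v t) + 1‖ < 1 ∧ HasDerivAt v (-Complex.I + ε * q (v t)) t) := by
  have hx' : |x - x₀| < δ := hx.trans (by linarith [hB.delta_pos])
  obtain ⟨vin, hvin⟩ := exists_inner_solution hB hε hS (norm_lowerCrossing_sub_le hB hy)
  set τ₀ := crossAngle x + crossAngle y with hτ₀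
  set τ₁ := innerTime ε S x y with hτ₁
  have hτ₀pos : 0 < τ₀ := add_pos (crossAngle_pos x) (crossAngle_pos y)
  have hτ₁pos : 0 < τ₁ := innerTime_pos hB hε hS hx' hy
  have hτ₁le : τ₁ ≤ 11 := innerTime_le hB hε hS hx' hy
  have hη := hB.eta_nonneg ε
  have hvin0 : vin 0 = lowerCrossing y := by
    obtain ⟨h1, h2, -⟩ := hvin 0 ⟨le_rfl, by norm_num⟩
    refine injOn_flowTime hB hε hS h1 (lowerCrossing_mem hB hy) ?_
    rw [h2, Complex.ofReal_zero, add_zero]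
  have hvin1 : vin τ₁ = upperCrossing x := by
    obtain ⟨h1, h2, -⟩ := hvin τ₁ ⟨hτ₁pos.le, hτ₁le⟩
    refine injOn_flowTime hB hε hS h1 (upperCrossing_mem hB hx') ?_
    rw [h2]
    apply Complex.ext
    · rw [Complex.add_re, Complex.ofReal_re, hτ₁, innerTime, Complex.sub_re]
      ring
    · rw [Complex.add_im, Complex.ofReal_im, add_zero, hxy.2]
  have hrin : ∀ s t, 0 ≤ s → s ≤ t → t ≤ 11 →
      ‖vin t - vin s + ((t - s : ℝ) : ℂ) * Complex.I‖ ≤ |ε| * C * (t - s) := by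
    intro s t h0 hst ht
    have hd : ∀ r ∈ Set.Icc (0 : ℝ) 11, HasDerivWithinAt
        (fun r : ℝ => vin r + (r : ℂ) * Complex.I) (ε * q (vin r)) (Set.Icc 0 11) r := by
      intro r hr
      have h1 := (hvin r hr).2.2
      have h2 : HasDerivAt (fun r : ℝ => (r : ℂ) * Complex.I) Complex.I r := by
        simpa using (Complex.ofRealCLM.hasDerivAt (x := r)).mul_const Complex.I
      convert! (h1.add h2).hasDerivWithinAt using 1
      ring
    have := (convex_Icc (0 : ℝ) 11).norm_image_sub_le_of_norm_hasDerivWithin_le hd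
      (fun r hr => norm_eps_mul_le (ε := ε) hB (hvin r hr).1) ⟨h0, hst.trans ht⟩
      ⟨h0.trans hst, ht⟩
    rw [Real.norm_of_nonneg (sub_nonneg.mpr hst)] at this
    have heq : vin t - vin s + ((t - s : ℝ) : ℂ) * Complex.I =
        vin t + (t : ℂ) * Complex.I - (vin s + (s : ℂ) * Complex.I) := by
      push_cast
      ring
    rw [heq]
    exact this
  set v : ℝ → ℂ := fun t => if t ≤ τ₀ then upperCrossing x + (-Complex.I + ε * a) * t
    else vin (t - τ₀) - 2 * Real.pi * Complex.I with hv
  have hvo : ∀ t, t ≤ τ₀ → v t = upperCrossing x + (-Complex.I + ε * a) * t := by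
    intro t ht; simp only [hv, if_pos ht]
  have hjoin : v τ₀ = lowerCrossing y - 2 * Real.pi * Complex.I := by
    rw [hvo τ₀ le_rfl]
    apply Complex.ext
    · simp only [upperCrossing, lowerCrossing]
      simp
      linarith [hxy.1]
    · simp only [upperCrossing, lowerCrossing]
      simp
      linarith
  have hvi : ∀ t, τ₀ ≤ t → v t = vin (t - τ₀) - 2 * Real.pi * Complex.I := by
    intro t ht
    rcases ht.eq_or_lt with rfl | h1
    · rw [hjoin, sub_self, hvin0]
    · simp only [hv, if_neg (not_le.mpr h1)]
  have hv0 : v 0 = upperCrossing x := by rw [hvo 0 hτ₀pos.le]; simp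
  have hvP : v (τ₀ + τ₁) = v 0 - 2 * Real.pi * Complex.I := by
    rw [hvi _ (by linarith), add_sub_cancel_left, hvin1, hv0]
  have hrot1 : ∀ s t, s ≤ t → t ≤ τ₀ →
      ‖v t - v s + ((t - s : ℝ) : ℂ) * Complex.I‖ ≤ |ε| * C * (t - s) := by
    intro s t hst ht
    rw [hvo t ht, hvo s (hst.trans ht)]
    have : upperCrossing x + (-Complex.I + ε * a) * t -
        (upperCrossing x + (-Complex.I + ε * a) * s) + ((t - s : ℝ) : ℂ) * Complex.I =
        ((ε * a * (t - s) : ℝ) : ℂ) := by push_cast; ring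
    rw [this, Complex.norm_real, Real.norm_eq_abs, abs_mul, abs_of_nonneg (sub_nonneg.mpr hst)]
    exact mul_le_mul_of_nonneg_right (abs_eps_mul_a_le hB) (sub_nonneg.mpr hst)
  have hrot2 : ∀ s t, τ₀ ≤ s → s ≤ t → t ≤ τ₀ + τ₁ →
      ‖v t - v s + ((t - s : ℝ) : ℂ) * Complex.I‖ ≤ |ε| * C * (t - s) := by
    intro s t hs hst ht
    rw [hvi t (hs.trans hst), hvi s hs]
    have := hrin (s - τ₀) (t - τ₀) (by linarith) (by linarith) (by linarith)
    rw [sub_sub_sub_cancel_right] at this ⊢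
    exact this
  have hrot : ∀ s t, 0 ≤ s → s ≤ t → t ≤ τ₀ + τ₁ →
      ‖v t - v s + ((t - s : ℝ) : ℂ) * Complex.I‖ ≤ |ε| * C * (t - s) := by
    intro s t _ hst ht
    rcases le_total t τ₀ with h1 | h1
    · exact hrot1 s t hst h1
    rcases le_total τ₀ s with h2 | h2
    · exact hrot2 s t h2 hst ht
    · calc ‖v t - v s + ((t - s : ℝ) : ℂ) * Complex.I‖
          = ‖(v t - v τ₀ + ((t - τ₀ : ℝ) : ℂ) * Complex.I) +
            (v τ₀ - v s + ((τ₀ - s : ℝ) : ℂ) * Complex.I)‖ := by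
            congr 1; push_cast; ring
        _ ≤ |ε| * C * (t - τ₀) + |ε| * C * (τ₀ - s) :=
            (norm_add_le _ _).trans (add_le_add (hrot2 τ₀ t le_rfl h1 ht) (hrot1 s τ₀ h2 le_rfl))
        _ = |ε| * C * (t - s) := by ring
  have hmem : ∀ t ∈ Set.Icc 0 (τ₀ + τ₁), |(v t).re - x₀| < δ := by
    intro t ht
    have h1 := (Complex.abs_re_le_norm _).trans (hrot 0 t le_rfl ht.1 ht.2)
    have h2 : (v t - v 0 + ((t - 0 : ℝ) : ℂ) * Complex.I).re = (v t).re - x := by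
      rw [hv0]; simp [upperCrossing]
    rw [h2, sub_zero] at h1
    have h3 : t ≤ 20 := by
      linarith [ht.2, crossAngle_le_pi x, crossAngle_le_pi y, Real.pi_lt_d2]
    have h4 := hε.drift
    have h5 : |ε| * C * t ≤ |ε| * C * 20 := mul_le_mul_of_nonneg_left h3 hη
    have h6 := abs_sub_le (v t).re x x₀
    linarith
  have hexp : ∀ z : ℂ, Complex.exp (z - 2 * Real.pi * Complex.I) = Complex.exp z := by
    intro z
    rw [Complex.exp_sub, Complex.exp_two_pi_mul_I, div_one]
  have hqs : ∀ z : ℂ, q (z - 2 * Real.pi * Complex.I) = q z := by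
    intro z
    rw [← hq (z - 2 * Real.pi * Complex.I), sub_add_cancel]
  refine ⟨v, τ₀ + τ₁, τ₀, hτ₀pos, by linarith, hv0, hvP, ?_, hrot, hmem, ?_⟩
  · rw [hjoin]; simp [lowerCrossing]
  · intro t ht hne
    have hmt := hmem t ⟨ht.1.le, ht.2.le⟩
    have hm0 := hmem 0 ⟨le_rfl, by linarith⟩
    have hmτ := hmem τ₀ ⟨hτ₀pos.le, by linarith⟩
    have hmP := hmem (τ₀ + τ₁) ⟨by linarith, le_rfl⟩
    rcases lt_or_gt_of_ne hne with hlt | hgt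
    · left
      have h1 := (angle_sub_crossAngle_le hB hε (sub_nonneg.mpr ht.1.le) hm0 hmt
        (hrot 0 t le_rfl ht.1.le ht.2.le)).1
      have h2 := (angle_sub_crossAngle_le hB hε (sub_nonneg.mpr hlt.le) hmt hmτ
        (hrot t τ₀ ht.1.le hlt.le (by linarith))).2
      rw [hv0] at h1
      rw [hjoin] at h2
      simp only [upperCrossing, lowerCrossing] at h1 h2
      simp at h1 h2
      refine ⟨one_lt_norm_exp_add_one (hB.lt_log_two _ hmt) (by linarith [ht.1]) (by linarith), ?_⟩
      have h3 : HasDerivAt (fun t : ℝ => upperCrossing x + (-Complex.I + ε * a) * t)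
          (-Complex.I + ε * a) t := by
        simpa using ((Complex.ofRealCLM.hasDerivAt (x := t)).const_mul
          (-Complex.I + ε * a)).const_add (upperCrossing x)
      refine h3.congr_of_eventuallyEq ?_
      filter_upwards [Iio_mem_nhds hlt] with r hr using hvo r (le_of_lt hr)
    · right
      have h1 := (angle_sub_crossAngle_le hB hε (sub_nonneg.mpr hgt.le) hmτ hmt
        (hrot τ₀ t hτ₀pos.le hgt.le ht.2.le)).2
      have h2 := (angle_sub_crossAngle_le hB hε (sub_nonneg.mpr ht.2.le) hmt hmP
        (hrot t (τ₀ + τ₁) ht.1.le ht.2.le le_rfl)).1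
      rw [hjoin] at h1
      rw [hvP, hv0] at h2
      simp only [upperCrossing, lowerCrossing] at h1 h2
      simp at h1 h2
      have hvt := hvi t hgt.le
      have hre : (vin (t - τ₀)).re = (v t).re := by rw [hvt]; simp
      have him : (vin (t - τ₀)).im = (v t).im + 2 * Real.pi := by rw [hvt]; simp
      have h5 : v t = vin (t - τ₀) - 2 * Real.pi * Complex.I := hvt
      constructor
      · rw [h5, hexp]
        refine norm_exp_add_one_lt_one ?_ ?_ ?_
        · rw [hre]; exact hB.lt_log_two _ hmt
        · rw [hre, him]; linarith [ht.2]
        · rw [hre, him]; linarith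
      · have h3 := (hvin (t - τ₀) ⟨by linarith, by linarith [ht.2]⟩).2.2
        rw [h5, hqs]
        have h4 := (h3.comp_sub_const t τ₀).sub_const (2 * Real.pi * Complex.I)
        refine h4.congr_of_eventuallyEq ?_
        filter_upwards [Ioi_mem_nhds hgt] with r hr using hvi r (le_of_lt hr)

/-- The Filippov field in the zone outside the disc `|z| ≤ 1`, in logarithmic form. -/
theorem HasLogForm.center_eq (hh : HasLogForm h a q) (ε : ℝ) (u : ℂ) :
    perturbedCenter h ε Zone.center (Complex.exp u + 1) =
      Complex.exp u * (-Complex.I + ε * a) := by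
  rw [perturbedCenter, hh.center, add_sub_cancel_right]
  ring

/-- The field in the disc `|z| < 1`, in logarithmic form. -/
theorem HasLogForm.plus_eq (hh : HasLogForm h a q) (ε : ℝ) (u : ℂ) :
    perturbedCenter h ε Zone.plus (Complex.exp u + 1) =
      Complex.exp u * (-Complex.I + ε * q u) := by
  rw [perturbedCenter, hh.plus, add_sub_cancel_right]
  ring

theorem HasLogForm.minus_eq (hh : HasLogForm h a q) (ε : ℝ) (z : ℂ) :
    perturbedCenter h ε Zone.minus z = perturbedCenter h ε Zone.center z := by
  rw [perturbedCenter, perturbedCenter, hh.minus]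

/-- A solution of the crossing equations gives a periodic orbit. -/
theorem Linked.exists_isPeriodicOrbit (hB : AnnulusBounds a q x₀ δ L C d)
    (hε : SmallParam ε δ L C d) (hq : ∀ v, q (v + 2 * Real.pi * Complex.I) = q v)
    (hh : HasLogForm h a q)
    (hS : IsTimePrimitive q x₀ ε S) {x y : ℝ} (hxy : Linked a ε S x y x)
    (hx : |x - x₀| < δ / 2) (hy : |y - x₀| < δ) :
    ∃ Γ, IsPeriodicOrbit (perturbedCenter h ε) Γ ∧ Γ ⊆ logAnnulus x₀ δ := by
  obtain ⟨v, P, τ₀, hτ₀, hτP, hv0, hvP, hvτ, hrot, hmem, hder⟩ :=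
    hxy.exists_closed_turn hB hε hq hS hx hy
  have hP : 0 < P := hτ₀.trans hτP
  have hη := hB.eta_nonneg ε
  have hvlip : ∀ s ∈ Set.Icc 0 P, ∀ t ∈ Set.Icc 0 P, ‖v t - v s‖ ≤ (|ε| * C + 1) * |t - s| := by
    intro s hs t ht
    wlog hst : s ≤ t generalizing s t
    · rw [norm_sub_rev, abs_sub_comm]
      exact this t ht s hs (le_of_not_ge hst)
    rw [abs_of_nonneg (sub_nonneg.mpr hst)]
    calc ‖v t - v s‖ = ‖(v t - v s + ((t - s : ℝ) : ℂ) * Complex.I) -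
          ((t - s : ℝ) : ℂ) * Complex.I‖ := by rw [add_sub_cancel_right]
      _ ≤ |ε| * C * (t - s) + (t - s) := by
          refine (norm_sub_le _ _).trans (add_le_add (hrot s t hs.1 hst ht.2) ?_)
          rw [norm_mul, Complex.norm_real, Complex.norm_I, mul_one,
            Real.norm_of_nonneg (sub_nonneg.mpr hst)]
      _ = (|ε| * C + 1) * (t - s) := by ring
  obtain ⟨K, hK⟩ := (Complex.contDiff_exp (n := 1) (𝕜 := ℝ)).contDiffOn.exists_lipschitzOnWith
    (by decide) (convex_closedBall (v 0) ((|ε| * C + 1) * P))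
    (isCompact_closedBall (v 0) ((|ε| * C + 1) * P))
  have hvball : ∀ t ∈ Set.Icc 0 P, v t ∈ Metric.closedBall (v 0) ((|ε| * C + 1) * P) := by
    intro t ht
    rw [mem_closedBall_iff_norm]
    refine (hvlip 0 ⟨le_rfl, hP.le⟩ t ht).trans ?_
    rw [sub_zero, abs_of_nonneg ht.1]
    exact mul_le_mul_of_nonneg_left ht.2 (by linarith)
  set f : ℝ → ℂ := fun t => Complex.exp (v t) + 1 with hf
  have hflip : ∀ s ∈ Set.Icc 0 P, ∀ t ∈ Set.Icc 0 P,
      ‖f t - f s‖ ≤ K * (|ε| * C + 1) * |t - s| := by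
    intro s hs t ht
    have h1 := hK.dist_le_mul _ (hvball t ht) _ (hvball s hs)
    rw [dist_eq_norm, dist_eq_norm] at h1
    simp only [hf, add_sub_add_right_eq_sub]
    calc _ ≤ _ := h1
      _ ≤ K * ((|ε| * C + 1) * |t - s|) := mul_le_mul_of_nonneg_left (hvlip s hs t ht) K.2
      _ = _ := by ring
  have hfend : f P = f 0 := by
    simp only [hf]
    rw [hvP, Complex.exp_sub, Complex.exp_two_pi_mul_I, div_one]
  have hmod : ∀ t, toIcoMod hP 0 t ∈ Set.Icc 0 P := by
    intro r
    have := toIcoMod_mem_Ico hP 0 r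
    rw [zero_add] at this
    exact ⟨this.1, this.2.le⟩
  set γ : ℝ → ℂ := fun t => f (toIcoMod hP 0 t) with hγ
  refine ⟨Set.range γ, ⟨γ, P, ⟨fun r s => ?_, ?_⟩, hP, fun t => ?_, ⟨0, τ₀, ?_⟩, rfl⟩, ?_⟩
  · have hL : LipschitzWith (Real.toNNReal (K * (|ε| * C + 1))) γ := by
      refine LipschitzWith.of_dist_le_mul fun t s => ?_
      rw [Real.coe_toNNReal _ (by positivity), dist_eq_norm, Real.dist_eq]
      exact norm_periodicExtension_sub_le hP hflip hfend s t
    exact hL.lipschitzOnWith.absolutelyContinuousOnInterval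
  · have hcount : (Set.range (fun n : ℤ => (n : ℝ) * P) ∪
        Set.range (fun n : ℤ => τ₀ + (n : ℝ) * P)).Countable :=
      (Set.countable_range _).union (Set.countable_range _)
    filter_upwards [hcount.ae_notMem MeasureTheory.volume] with t ht
    have hdec := toIcoMod_add_toIcoDiv_zsmul hP 0 t
    rw [zsmul_eq_mul] at hdec
    have h0 : toIcoMod hP 0 t ≠ 0 := by
      intro h0
      exact ht (Or.inl ⟨toIcoDiv hP 0 t, by simp only; linarith⟩)
    have hτ : toIcoMod hP 0 t ≠ τ₀ := by
      intro h0
      exact ht (Or.inr ⟨toIcoDiv hP 0 t, by simp only; linarith⟩)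
    have hpos : 0 < toIcoMod hP 0 t := lt_of_le_of_ne (hmod t).1 (Ne.symm h0)
    have hltP : toIcoMod hP 0 t < P := by simpa using toIcoMod_lt_right hP 0 t
    rcases hder _ ⟨hpos, hltP⟩ hτ with ⟨h1, h2⟩ | ⟨h1, h2⟩
    · refine ⟨_, center_mem_filippovField (hh.minus_eq ε _) h1, ?_⟩
      refine hasDerivAt_periodicExtension hP hpos ?_
      rw [hh.center_eq]
      exact (h2.cexp).add_const 1
    · refine ⟨_, plus_mem_filippovField h1, ?_⟩
      refine hasDerivAt_periodicExtension hP hpos ?_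
      rw [hh.plus_eq]
      exact (h2.cexp).add_const 1
  · simp only [hγ, toIcoMod_add_right]
  · -- The two crossing points lie in opposite half planes.
    have h0 : toIcoMod hP 0 0 = 0 := by
      rw [toIcoMod_eq_self]; exact ⟨le_rfl, by simpa using hP⟩
    have h1 : toIcoMod hP 0 τ₀ = τ₀ := by
      rw [toIcoMod_eq_self]; exact ⟨hτ₀.le, by simpa using hτP⟩
    simp only [hγ, hf, h0, h1]
    intro heq
    have him := congrArg Complex.im heq
    simp only [Complex.add_im, Complex.exp_im, Complex.one_im, add_zero] at him
    have hx' : |x - x₀| < δ := hx.trans (by linarith [hB.delta_pos])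
    have hyτ := hmem τ₀ ⟨hτ₀.le, hτP.le⟩
    rw [hvτ, hv0, Real.sin_neg] at him
    simp only [upperCrossing] at him
    have h2 : 0 < Real.sin (crossAngle x) := Real.sin_pos_of_pos_of_lt_pi (crossAngle_pos _)
      (by linarith [hB.gap _ hx', hB.gap_pos])
    have h3 : 0 < Real.sin (crossAngle (v τ₀).re) :=
      Real.sin_pos_of_pos_of_lt_pi (crossAngle_pos _) (by linarith [hB.gap _ hyτ, hB.gap_pos])
    have h4 := mul_pos (Real.exp_pos x) h2
    have h5 := mul_pos (Real.exp_pos (v τ₀).re) h3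
    linarith
  · rintro _ ⟨t, rfl⟩
    refine ⟨?_, ?_⟩
    · simp only [hγ, hf]
      intro h0
      exact Complex.exp_ne_zero _ (add_eq_right.mp h0)
    · simp only [hγ, hf, add_sub_cancel_right, Complex.norm_exp, Real.log_exp]
      exact hmem _ (hmod t)

/-- Every Filippov solution in the annulus lifts to a logarithmic orbit. -/
theorem exists_isLogOrbit (hB : AnnulusBounds a q x₀ δ L C d) (hh : HasLogForm h a q)
    {γ : ℝ → ℂ} (hγ : IsFilippovSolution (perturbedCenter h ε) γ)
    (hmem : ∀ t, γ t ∈ logAnnulus x₀ δ) :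
    ∃ u, IsLogOrbit a q x₀ δ C ε u ∧ ∀ t, Complex.exp (u t) = γ t - 1 := by
  have hne : ∀ t, γ t - 1 ≠ 0 := fun t => sub_ne_zero.mpr (hmem t).1
  have hbound : ∀ t σ, ‖(h σ).eval (γ t)‖ ≤ C * ‖γ t - 1‖ := by
    intro t σ
    have hc : ‖(h Zone.center).eval (γ t)‖ ≤ C * ‖γ t - 1‖ := by
      rw [hh.center, norm_mul, Complex.norm_real]
      exact mul_le_mul_of_nonneg_right hB.abs_le (norm_nonneg _)
    cases σ with
    | center => exact hc
    | minus => rw [hh.minus]; exact hc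
    | plus =>
      have h1 := hh.plus (Complex.log (γ t - 1))
      rw [Complex.exp_log (hne t), sub_add_cancel] at h1
      rw [h1, norm_mul]
      refine mul_le_mul_of_nonneg_right (hB.bound _ ?_) (norm_nonneg _)
      rw [mem_ball_iff_norm]
      refine (Complex.norm_le_abs_re_add_abs_im _).trans_lt ?_
      have h2 := (hmem t).2
      have h3 := Complex.abs_arg_le_pi (γ t - 1)
      simp only [Complex.sub_re, Complex.sub_im, Complex.log_re, Complex.log_im,
        Complex.ofReal_re, Complex.ofReal_im, sub_zero] at h2 h3 ⊢
      linarith [hB.delta_le, Real.pi_lt_d2]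
  obtain ⟨u, hexp, hrot, hder⟩ := exists_log_lift (η := |ε| * C) hγ.1 (fun t => (hmem t).1) (by
    filter_upwards [hγ.2] with t ⟨v, hv, hvd⟩
    refine ⟨v, hvd, ?_⟩
    have h1 := norm_sub_le_of_mem_filippovField (hbound t) hv
    have h2 : v / (γ t - 1) + Complex.I = (v + Complex.I * (γ t - 1)) / (γ t - 1) := by
      rw [add_div, mul_div_cancel_right₀ _ (hne t)]
    rw [h2, norm_div, div_le_iff₀ (norm_pos_iff.mpr (hne t))]
    linarith)
  have hz : ∀ t, γ t = Complex.exp (u t) + 1 := fun t => by rw [hexp]; ring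
  refine ⟨u, ⟨hrot, fun t => ?_, ?_, ?_⟩, hexp⟩
  · have := (hmem t).2
    rwa [← hexp t, Complex.norm_exp, Real.log_exp] at this
  · filter_upwards [hder, hγ.2] with t ht ⟨v, hv, hvd⟩ h1
    rw [← hz] at h1
    have h2 := eq_of_mem_filippovField_of_one_lt (hh.minus_eq ε _) h1 hv
    rw [hvd.deriv, h2, hz t, hh.center_eq, add_sub_cancel_right,
      mul_div_cancel_left₀ _ (Complex.exp_ne_zero _)] at ht
    exact ht
  · filter_upwards [hder, hγ.2] with t ht ⟨v, hv, hvd⟩ h1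
    rw [← hz] at h1
    have h2 := eq_of_mem_filippovField_of_lt_one h1 hv
    rw [hvd.deriv, h2, hz t, hh.plus_eq, add_sub_cancel_right,
      mul_div_cancel_left₀ _ (Complex.exp_ne_zero _)] at ht
    exact ht

/-- Every periodic orbit in the annulus is the curve of a solution of the crossing equations. -/
theorem IsPeriodicOrbit.eq_image_returnCurve (hB : AnnulusBounds a q x₀ δ L C d)
    (hε : SmallParam ε δ L C d) (hq : ∀ v, q (v + 2 * Real.pi * Complex.I) = q v)
    (hh : HasLogForm h a q) (hS : IsTimePrimitive q x₀ ε S) {Γ : Set ℂ}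
    (hΓ : IsPeriodicOrbit (perturbedCenter h ε) Γ) (hsub : Γ ⊆ logAnnulus x₀ δ) :
    ∃ x y, |x - x₀| < δ ∧ |y - x₀| < δ ∧ Linked a ε S x y x ∧
      Γ = (fun w => w + 1) '' returnCurve a ε S x₀ x y := by
  obtain ⟨γ, P, hγ, hP, hper, -, rfl⟩ := hΓ
  obtain ⟨u, hu, hexp⟩ := exists_isLogOrbit hB hh hγ fun t => hsub ⟨t, rfl⟩
  obtain ⟨x, y, hx, hy, hxy, hr⟩ := hu.range_exp_eq hB hε hq hS hP fun t => by
    rw [hexp, hexp, hper t]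
  refine ⟨x, y, hx, hy, hxy, ?_⟩
  rw [← hr, ← Set.range_comp]
  congr 1
  funext t
  simp [hexp]

/-- A periodic orbit in the annulus meets every ray from `1`. -/
theorem IsPeriodicOrbit.exists_mem_ray (hB : AnnulusBounds a q x₀ δ L C d)
    (hε : SmallParam ε δ L C d) (hh : HasLogForm h a q) {Γ : Set ℂ}
    (hΓ : IsPeriodicOrbit (perturbedCenter h ε) Γ) (hsub : Γ ⊆ logAnnulus x₀ δ) (θ : ℝ) :
    ∃ x : ℝ, |x - x₀| < δ ∧ Complex.exp (x + θ * Complex.I) + 1 ∈ Γ := by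
  obtain ⟨γ, P, hγ, hP, hper, -, rfl⟩ := hΓ
  obtain ⟨u, hu, hexp⟩ := exists_isLogOrbit hB hh hγ fun t => hsub ⟨t, rfl⟩
  obtain ⟨t, ht⟩ := hu.exists_im_eq hB hε θ
  refine ⟨(u t).re, hu.mem t, t, ?_⟩
  rw [← ht, Complex.re_add_im, hexp]
  ring

end

/-! ### Solving the crossing equations -/

/-- A zero at which a map has an invertible strict derivative persists, and stays unique in a
fixed ball, under perturbations that are small in the Lipschitz sense. -/
theorem exists_zero_of_lipschitz_perturbation {E : Type*} [NormedAddCommGroup E]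
    [NormedSpace ℝ E] [CompleteSpace E] [Nontrivial E] {Φ₀ : E → E} {f' : E ≃L[ℝ] E} {p : E}
    (h : HasStrictFDerivAt Φ₀ (f' : E →L[ℝ] E) p) :
    ∃ R > 0, ∀ r₀, 0 < r₀ → r₀ ≤ R → ∀ r, 0 < r → ∃ κ > 0, ∀ Φ : E → E,
      (∀ z ∈ Metric.ball p r₀, ∀ w ∈ Metric.ball p r₀,
        ‖(Φ z - Φ₀ z) - (Φ w - Φ₀ w)‖ ≤ κ * ‖z - w‖) → ‖Φ p‖ ≤ κ →
      Set.InjOn Φ (Metric.ball p r₀) ∧ ∃ z ∈ Metric.ball p r, Φ z = 0 := by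
  set N : NNReal := ‖(f'.symm : E →L[ℝ] E)‖₊ with hN
  have hNpos : 0 < N := f'.nnnorm_symm_pos
  have hNi : 0 < N⁻¹ := inv_pos.mpr hNpos
  obtain ⟨s, hs, happ⟩ := h.approximates_deriv_on_nhds (c := N⁻¹ / 4) (Or.inr (by positivity))
  obtain ⟨R, hR, hRs⟩ := Metric.mem_nhds_iff.mp hs
  refine ⟨R, hR, fun r₀ hr₀ hr₀R r hr => ?_⟩
  set ρ := min r₀ r / 2 with hρ
  have hmin : 0 < min r₀ r := lt_min hr₀ hr
  have hρ0 : 0 < ρ := by positivity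
  have hρr₀ : ρ < r₀ := by linarith [min_le_left r₀ r]
  have hρr : ρ < r := by linarith [min_le_right r₀ r]
  have hNr : 0 < (N⁻¹ : NNReal).toReal := hNi
  refine ⟨min ((N⁻¹ : NNReal) / 4) ((N⁻¹ : NNReal) / 2 * ρ), by positivity, fun Φ hlip hp => ?_⟩
  have happΦ : ApproximatesLinearOn Φ (f' : E →L[ℝ] E) (Metric.ball p r₀) (N⁻¹ / 2) := by
    intro z hz w hw
    have h1 := happ z (hRs (Metric.ball_subset_ball hr₀R hz)) w
      (hRs (Metric.ball_subset_ball hr₀R hw))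
    have h2 := hlip z hz w hw
    have h3 : Φ z - Φ w - f' (z - w) =
        (Φ₀ z - Φ₀ w - f' (z - w)) + ((Φ z - Φ₀ z) - (Φ w - Φ₀ w)) := by abel
    have h4 : min ((N⁻¹ : NNReal) / 4 : ℝ) ((N⁻¹ : NNReal) / 2 * ρ) * ‖z - w‖ ≤
        (N⁻¹ : NNReal) / 4 * ‖z - w‖ :=
      mul_le_mul_of_nonneg_right (min_le_left _ _) (norm_nonneg _)
    change ‖Φ z - Φ w - f' (z - w)‖ ≤ _
    rw [h3]
    refine (norm_add_le _ _).trans ?_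
    have h5 : ((N⁻¹ / 4 : NNReal) : ℝ) = (N⁻¹ : NNReal) / 4 := by push_cast; rfl
    have h6 : ((N⁻¹ / 2 : NNReal) : ℝ) = (N⁻¹ : NNReal) / 2 := by push_cast; rfl
    rw [h5] at h1
    rw [h6]
    have h7 : ‖Φ₀ z - Φ₀ w - f' (z - w)‖ ≤ (N⁻¹ : NNReal) / 4 * ‖z - w‖ := h1
    linarith
  have hc : N⁻¹ / 2 < N⁻¹ := NNReal.half_lt_self hNi.ne'
  refine ⟨happΦ.injOn (Or.inr hc), ?_⟩
  have hsub : Metric.closedBall p ρ ⊆ Metric.ball p r₀ := Metric.closedBall_subset_ball hρr₀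
  have hsurj := happΦ.surjOn_closedBall_of_nonlinearRightInverse f'.toNonlinearRightInverse
    hρ0.le hsub
  obtain ⟨z, hz, hz0⟩ := hsurj (a := 0) (by
    rw [mem_closedBall_iff_norm, zero_sub, norm_neg]
    refine (hp.trans (min_le_right _ _)).trans_eq ?_
    have h6 : ((N⁻¹ / 2 : NNReal) : ℝ) = (N⁻¹ : NNReal) / 2 := by push_cast; rfl
    rw [h6]
    have h7 : ((f'.toNonlinearRightInverse.nnnorm : NNReal) : ℝ)⁻¹ = (N⁻¹ : NNReal) := by
      push_cast; rfl
    rw [h7]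
    ring)
  exact ⟨z, Metric.closedBall_subset_ball hρr hz, hz0⟩

/-- The crossing equations, desingularised at `ε = 0`: the difference of the two first integrals
is divided by `ε`. -/
noncomputable def crossingMap (a ε : ℝ) (S : ℂ → ℂ) (p : ℝ × ℝ) : ℝ × ℝ :=
  (p.2 - p.1 - ε * a * (crossAngle p.1 + crossAngle p.2),
    -a * (crossAngle p.1 + crossAngle p.2) +
      ((S (upperCrossing p.1)).im - (S (lowerCrossing p.2)).im))

/-- The first-order displacement of the circle `log |w| = x`, where `V` is a primitive of the
inner field `q`. -/
noncomputable def melnikov (a : ℝ) (V : ℂ → ℂ) (x : ℝ) : ℝ :=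
  (crossingMap a 0 V (x, x)).2

theorem linked_iff {a ε : ℝ} {S : ℂ → ℂ} {x y : ℝ} (hε : ε ≠ 0) :
    Linked a ε S x y x ↔ crossingMap a ε S (x, y) = 0 := by
  simp only [Linked, crossingMap, Prod.mk_eq_zero, flowTime, Complex.add_im, Complex.mul_im,
    Complex.I_re, Complex.I_im, Complex.ofReal_re, Complex.ofReal_im, zero_mul, one_mul, zero_add,
    add_zero]
  have hu : (upperCrossing x).re = x := rfl
  have hl : (lowerCrossing y).re = y := rfl
  rw [hu, hl]
  constructor
  · rintro ⟨h1, h2⟩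
    refine ⟨by linarith, ?_⟩
    have : ε * (-a * (crossAngle x + crossAngle y) +
        ((S (upperCrossing x)).im - (S (lowerCrossing y)).im)) = 0 := by linarith
    exact (mul_eq_zero.mp this).resolve_left hε
  · rintro ⟨h1, h2⟩
    have : ε * (-a * (crossAngle x + crossAngle y) +
        ((S (upperCrossing x)).im - (S (lowerCrossing y)).im)) = 0 := by rw [h2, mul_zero]
    exact ⟨by linarith, by linarith⟩

theorem contDiffAt_crossAngle {x : ℝ} (hx : x < Real.log 2) : ContDiffAt ℝ 1 crossAngle x := by
  have h1 := exp_lt_two hx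
  have h2 := Real.exp_pos x
  have h3 : ContDiffAt ℝ 1 Real.arccos (-(Real.exp x) / 2) :=
    Real.contDiffAt_arccos (by linarith) (by linarith)
  have h4 : ContDiffAt ℝ 1 (fun x => -(Real.exp x) / 2) x :=
    (Real.contDiff_exp.contDiffAt.neg).div_const 2
  exact h3.comp x h4

theorem crossAngle_lt_pi {x : ℝ} (hx : x < Real.log 2) : crossAngle x < Real.pi := by
  refine lt_of_le_of_ne (crossAngle_le_pi x) fun h => ?_
  have h1 := cos_crossAngle hx
  rw [h, Real.cos_pi] at h1
  linarith [exp_lt_two hx]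

/-- The bounds of `AnnulusBounds` hold on all thin enough annuli, with constants that do not
depend on the width. -/
theorem exists_annulusBounds {a x₀ : ℝ} {q : ℂ → ℂ} (hx₀ : x₀ < Real.log 2)
    (hq : Differentiable ℂ q) :
    ∃ R > 0, ∃ L C d, ∀ δ, 0 < δ → δ ≤ R → AnnulusBounds a q x₀ δ L C d := by
  obtain ⟨K, s, hs, hK⟩ := (contDiffAt_crossAngle hx₀).exists_lipschitzOnWith
  obtain ⟨R₁, hR₁, hRs⟩ := Metric.mem_nhds_iff.mp hs
  have hπ := crossAngle_lt_pi hx₀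
  set d := (Real.pi - crossAngle x₀) / 2 with hd
  have hgap : ∀ᶠ x in nhds x₀, crossAngle x < Real.pi - d :=
    continuous_crossAngle.continuousAt.eventually_lt continuousAt_const (by linarith)
  obtain ⟨R₂, hR₂, hRg⟩ := Metric.eventually_nhds_iff_ball.mp hgap
  obtain ⟨C, hC⟩ := (isCompact_closedBall (x₀ : ℂ) 30).exists_bound_of_continuousOn
    hq.continuous.continuousOn
  refine ⟨min (min R₁ R₂) (min 1 (Real.log 2 - x₀)),
    lt_min (lt_min hR₁ hR₂) (lt_min one_pos (by linarith)), K, max C |a|, d, fun δ hδ hδR => ?_⟩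
  have h1 : δ ≤ R₁ := hδR.trans ((min_le_left _ _).trans (min_le_left _ _))
  have h2 : δ ≤ R₂ := hδR.trans ((min_le_left _ _).trans (min_le_right _ _))
  have h3 : δ ≤ 1 := hδR.trans ((min_le_right _ _).trans (min_le_left _ _))
  have h4 : δ ≤ Real.log 2 - x₀ := hδR.trans ((min_le_right _ _).trans (min_le_right _ _))
  have hmem : ∀ {x r : ℝ}, |x - x₀| < δ → δ ≤ r → x ∈ Metric.ball x₀ r := by
    intro x r hx hr
    rw [Metric.mem_ball, Real.dist_eq]
    linarith
  refine ⟨hδ, h3, fun x hx => ?_, K.2, fun x y hx hy => ?_, by linarith, fun x hx => ?_,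
    le_max_right _ _, fun u hu => ?_, hq⟩
  · linarith [(abs_lt.mp hx).2]
  · have := hK.dist_le_mul x (hRs (hmem hx h1)) y (hRs (hmem hy h1))
    rwa [Real.dist_eq, Real.dist_eq] at this
  · exact (hRg x (hmem hx h2)).le
  · exact (hC u (Metric.ball_subset_closedBall hu)).trans (le_max_left _ _)

theorem exists_smallParam {δ L C d : ℝ} (hδ : 0 < δ) (hL : 0 ≤ L) (hC : 0 ≤ C) (hd : 0 < d) :
    ∃ ε₁ > 0, ∀ ε : ℝ, 0 < |ε| → |ε| < ε₁ → SmallParam ε δ L C d := by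
  have hden : 0 < 40 * (C + 1) * (1 + L) := by positivity
  refine ⟨min 1 (min d δ) / (40 * (C + 1) * (1 + L)), by positivity, fun ε hε hlt => ?_⟩
  rw [lt_div_iff₀ hden] at hlt
  have h1 : min 1 (min d δ) ≤ 1 := min_le_left _ _
  have h2 : min 1 (min d δ) ≤ d := (min_le_right _ _).trans (min_le_left _ _)
  have h3 : min 1 (min d δ) ≤ δ := (min_le_right _ _).trans (min_le_right _ _)
  have h4 : 40 * (|ε| * C) * (1 + L) ≤ |ε| * (40 * (C + 1) * (1 + L)) := by nlinarith
  have h5 : 0 ≤ |ε| * C := by positivity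
  have h6 : 0 ≤ |ε| * C * L := by positivity
  exact ⟨abs_pos.mp hε, by nlinarith, by nlinarith, by nlinarith⟩

section
variable {a : ℝ} {q V : ℂ → ℂ} {x₀ δ L C d ε : ℝ} {S : ℂ → ℂ}

/-- At `ε = 0` the crossing map has an invertible derivative at a simple zero of the displacement
function. -/
theorem exists_hasStrictFDerivAt_crossingMap (hx₀ : x₀ < Real.log 2)
    (hV : Differentiable ℂ V) {m : ℝ} (hm : m ≠ 0) (hM : HasDerivAt (melnikov a V) m x₀) :
    ∃ f' : (ℝ × ℝ) ≃L[ℝ] ℝ × ℝ,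
      HasStrictFDerivAt (crossingMap a 0 V) (f' : ℝ × ℝ →L[ℝ] ℝ × ℝ) (x₀, x₀) := by
  have hVR : ContDiff ℝ 1 V := (hV.contDiff (n := 1)).restrict_scalars ℝ
  have hΘ := contDiffAt_crossAngle hx₀
  have hup : ContDiffAt ℝ 1 upperCrossing x₀ := by
    have : upperCrossing = fun x : ℝ => (x : ℂ) + (crossAngle x : ℂ) * Complex.I := by
      funext x; exact Complex.mk_eq_add_mul_I _ _
    rw [this]
    exact Complex.ofRealCLM.contDiff.contDiffAt.add
      ((Complex.ofRealCLM.contDiff.contDiffAt.comp x₀ hΘ).mul contDiffAt_const)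
  have hlo : ContDiffAt ℝ 1 lowerCrossing x₀ := by
    have : lowerCrossing =
        fun x : ℝ => (x : ℂ) + ((2 * Real.pi - crossAngle x : ℝ) : ℂ) * Complex.I := by
      funext x; exact Complex.mk_eq_add_mul_I _ _
    rw [this]
    exact Complex.ofRealCLM.contDiff.contDiffAt.add
      ((Complex.ofRealCLM.contDiff.contDiffAt.comp x₀ (contDiffAt_const.sub hΘ)).mul
        contDiffAt_const)
  have h1 : ContDiffAt ℝ 1 (fun x => -a * crossAngle x + (V (upperCrossing x)).im) x₀ :=
    (contDiffAt_const.mul hΘ).add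
      (Complex.imCLM.contDiff.contDiffAt.comp x₀ (hVR.contDiffAt.comp x₀ hup))
  have h2 : ContDiffAt ℝ 1 (fun x => -a * crossAngle x - (V (lowerCrossing x)).im) x₀ :=
    (contDiffAt_const.mul hΘ).sub
      (Complex.imCLM.contDiff.contDiffAt.comp x₀ (hVR.contDiffAt.comp x₀ hlo))
  have hd1 := h1.hasStrictDerivAt one_ne_zero
  have hd2 := h2.hasStrictDerivAt one_ne_zero
  set α := deriv (fun x => -a * crossAngle x + (V (upperCrossing x)).im) x₀
  set β := deriv (fun x => -a * crossAngle x - (V (lowerCrossing x)).im) x₀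
  have hsum : α + β = m := by
    have heq : melnikov a V = (fun x => -a * crossAngle x + (V (upperCrossing x)).im) +
        fun x => -a * crossAngle x - (V (lowerCrossing x)).im := by
      funext x
      simp only [melnikov, crossingMap, Pi.add_apply]
      ring
    rw [heq] at hM
    exact (hd1.hasDerivAt.add hd2.hasDerivAt).unique hM
  have hl : ∃ e : (ℝ × ℝ) ≃ₗ[ℝ] ℝ × ℝ, ∀ z, e z = (z.2 - z.1, α * z.1 + β * z.2) := by
    refine ⟨{ toFun := fun z => (z.2 - z.1, α * z.1 + β * z.2)
              map_add' := fun z w => by ext <;> simp <;> ring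
              map_smul' := fun c z => by ext <;> simp <;> ring
              invFun := fun w => ((w.2 - β * w.1) / m, (w.2 - β * w.1) / m + w.1)
              left_inv := fun z => ?_
              right_inv := fun w => ?_ }, fun z => rfl⟩
    · ext <;> simp only <;> field_simp <;> rw [← hsum] <;> ring
    · ext <;> simp only
      · ring
      · field_simp
        rw [← hsum]
        ring
  obtain ⟨e, he⟩ := hl
  refine ⟨e.toContinuousLinearEquiv, ?_⟩
  have hfst : HasStrictFDerivAt (fun z : ℝ × ℝ => z.1) (ContinuousLinearMap.fst ℝ ℝ ℝ) (x₀, x₀) :=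
    hasStrictFDerivAt_fst
  have hsnd : HasStrictFDerivAt (fun z : ℝ × ℝ => z.2) (ContinuousLinearMap.snd ℝ ℝ ℝ) (x₀, x₀) :=
    hasStrictFDerivAt_snd
  have hA := HasStrictDerivAt.comp_hasStrictFDerivAt (x₀, x₀) (f := fun z : ℝ × ℝ => z.1) hd1 hfst
  have hB := HasStrictDerivAt.comp_hasStrictFDerivAt (x₀, x₀) (f := fun z : ℝ × ℝ => z.2) hd2 hsnd
  have hall := (hsnd.sub hfst).prodMk (hA.add hB)
  convert! hall using 1
  · funext z
    simp only [crossingMap, Pi.add_apply, Pi.sub_apply, Function.comp_apply]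
    ext
    · simp
    · simp only
      ring
  · ext <;> simp [he]

/-- The perturbation of the primitive is Lipschitz with a constant of order `ε`. -/
theorem norm_primitive_sub_le (hB : AnnulusBounds a q x₀ δ L C d) (hε : SmallParam ε δ L C d)
    (hV : ∀ u, HasDerivAt V (q u) u) (hS : IsTimePrimitive q x₀ ε S) {u v : ℂ}
    (hu : u ∈ Metric.ball (x₀ : ℂ) 30) (hv : v ∈ Metric.ball (x₀ : ℂ) 30) :
    ‖(S v - V v) - (S u - V u)‖ ≤ 2 * (|ε| * C) * C * ‖v - u‖ := by
  refine (convex_ball (x₀ : ℂ) 30).norm_image_sub_le_of_norm_hasDerivWithin_le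
    (f := fun w => S w - V w) (f' := fun w => q w / (1 + Complex.I * ε * q w) - q w)
    (fun w hw => ((hS w hw).sub (hV w)).hasDerivWithinAt) (fun w hw => ?_) hu hv
  have h1 := half_le_norm_one_add hB hε hw
  have h2 := norm_eps_mul_le (ε := ε) hB hw
  have h3 := one_add_ne_zero hB hε hw
  have h4 : q w / (1 + Complex.I * ε * q w) - q w =
      -Complex.I * (ε * q w) * q w / (1 + Complex.I * ε * q w) := by
    rw [eq_div_iff h3, sub_mul, div_mul_cancel₀ _ h3]
    ring
  rw [h4, norm_div, norm_mul, norm_mul, norm_neg, Complex.norm_I, one_mul,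
    div_le_iff₀ (by linarith)]
  have h5 := hB.bound w hw
  have h6 : ‖(ε : ℂ) * q w‖ * ‖q w‖ ≤ |ε| * C * C :=
    mul_le_mul h2 h5 (norm_nonneg _) (hB.eta_nonneg ε)
  have h7 : 0 ≤ |ε| * C * C := mul_nonneg (hB.eta_nonneg ε) hB.C_nonneg
  nlinarith

/-- On the square `|x - x₀|, |y - x₀| < δ` the crossing map differs from the one at `ε = 0` by a
function which is Lipschitz with a constant of order `ε`. -/
theorem norm_crossingMap_sub_le (hB : AnnulusBounds a q x₀ δ L C d) (hε : SmallParam ε δ L C d)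
    (hV : ∀ u, HasDerivAt V (q u) u) (hS : IsTimePrimitive q x₀ ε S) {z w : ℝ × ℝ}
    (hz : z ∈ Metric.ball (x₀, x₀) δ) (hw : w ∈ Metric.ball (x₀, x₀) δ) :
    ‖(crossingMap a ε S z - crossingMap a 0 V z) - (crossingMap a ε S w - crossingMap a 0 V w)‖ ≤
      |ε| * (40 * (1 + C) ^ 2 * (1 + L)) * ‖z - w‖ := by
  have hball : ∀ z ∈ Metric.ball (x₀, x₀) δ, |z.1 - x₀| < δ ∧ |z.2 - x₀| < δ := by
    intro z hz
    rwa [Metric.mem_ball, Prod.dist_eq, max_lt_iff, Real.dist_eq, Real.dist_eq] at hz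
  obtain ⟨hz1, hz2⟩ := hball z hz
  obtain ⟨hw1, hw2⟩ := hball w hw
  have hn1 : |z.1 - w.1| ≤ ‖z - w‖ := norm_fst_le (z - w)
  have hn2 : |z.2 - w.2| ≤ ‖z - w‖ := norm_snd_le (z - w)
  have hL := hB.lip_nonneg
  have hC := hB.C_nonneg
  have hη := hB.eta_nonneg ε
  have hn := norm_nonneg (z - w)
  have hΘ1 := (hB.lip _ _ hz1 hw1).trans (mul_le_mul_of_nonneg_left hn1 hL)
  have hΘ2 := (hB.lip _ _ hz2 hw2).trans (mul_le_mul_of_nonneg_left hn2 hL)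
  have hU := norm_primitive_sub_le hB hε hV hS (upperCrossing_mem hB hw1) (upperCrossing_mem hB hz1)
  have hD := norm_primitive_sub_le hB hε hV hS (lowerCrossing_mem hB hw2) (lowerCrossing_mem hB hz2)
  have hU' := (norm_upperCrossing_sub hB hw1 hz1).trans
    (mul_le_mul_of_nonneg_left hn1 (by linarith))
  have hD' := (norm_lowerCrossing_sub hB hw2 hz2).trans
    (mul_le_mul_of_nonneg_left hn2 (by linarith))
  have hk : 0 ≤ 2 * (|ε| * C) * C := by positivity
  have hU2 := (Complex.abs_im_le_norm _).trans (hU.trans (mul_le_mul_of_nonneg_left hU' hk))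
  have hD2 := (Complex.abs_im_le_norm _).trans (hD.trans (mul_le_mul_of_nonneg_left hD' hk))
  simp only [Complex.sub_im] at hU2 hD2
  have hp1 : 0 ≤ |ε| * ‖z - w‖ := by positivity
  have hp2 : 0 ≤ |ε| * ‖z - w‖ * C := by positivity
  have hp3 : 0 ≤ |ε| * ‖z - w‖ * L := by positivity
  have hp4 : 0 ≤ |ε| * ‖z - w‖ * C * L := by positivity
  have hp5 : 0 ≤ |ε| * ‖z - w‖ * C * C := by positivity
  have hp6 : 0 ≤ |ε| * ‖z - w‖ * C * C * L := by positivity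
  refine max_le ?_ ?_
  · have h1 : ((crossingMap a ε S z - crossingMap a 0 V z) -
        (crossingMap a ε S w - crossingMap a 0 V w)).1 =
        -(ε * a * ((crossAngle z.1 - crossAngle w.1) + (crossAngle z.2 - crossAngle w.2))) := by
      simp only [crossingMap, Prod.fst_sub]
      ring
    rw [h1, norm_neg, Real.norm_eq_abs, abs_mul]
    have h2 : |ε * a| * |(crossAngle z.1 - crossAngle w.1) + (crossAngle z.2 - crossAngle w.2)| ≤
        |ε| * C * (L * ‖z - w‖ + L * ‖z - w‖) :=
      mul_le_mul (abs_eps_mul_a_le hB) ((abs_add_le _ _).trans (add_le_add hΘ1 hΘ2))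
        (abs_nonneg _) hη
    nlinarith
  · have h1 : ((crossingMap a ε S z - crossingMap a 0 V z) -
        (crossingMap a ε S w - crossingMap a 0 V w)).2 =
        ((S (upperCrossing z.1)).im - (V (upperCrossing z.1)).im -
          ((S (upperCrossing w.1)).im - (V (upperCrossing w.1)).im)) -
        ((S (lowerCrossing z.2)).im - (V (lowerCrossing z.2)).im -
          ((S (lowerCrossing w.2)).im - (V (lowerCrossing w.2)).im)) := by
      simp only [crossingMap, Prod.snd_sub]
      ring
    rw [h1, Real.norm_eq_abs]
    refine (abs_sub _ _).trans ?_
    nlinarith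

theorem norm_crossingMap_center_le (hB : AnnulusBounds a q x₀ δ L C d)
    (hε : SmallParam ε δ L C d) (hV : ∀ u, HasDerivAt V (q u) u)
    (hS : IsTimePrimitive q x₀ ε S) (hM : melnikov a V x₀ = 0) :
    ‖crossingMap a ε S (x₀, x₀)‖ ≤ |ε| * (40 * (1 + C) ^ 2 * (1 + L)) := by
  have hx : |x₀ - x₀| < δ := by simpa using hB.delta_pos
  have hL := hB.lip_nonneg
  have hC := hB.C_nonneg
  have hp1 : 0 ≤ |ε| := abs_nonneg ε
  have hp2 : 0 ≤ |ε| * C := by positivity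
  have hp3 : 0 ≤ |ε| * L := by positivity
  have hp4 : 0 ≤ |ε| * C * L := by positivity
  have hp5 : 0 ≤ |ε| * C * C := by positivity
  have hp6 : 0 ≤ |ε| * C * C * L := by positivity
  refine max_le ?_ ?_
  · have h1 : (crossingMap a ε S (x₀, x₀)).1 = -(ε * a * (2 * crossAngle x₀)) := by
      simp only [crossingMap]
      ring
    rw [h1, norm_neg, Real.norm_eq_abs, abs_mul,
      abs_of_nonneg (by linarith [crossAngle_nonneg x₀] : 0 ≤ 2 * crossAngle x₀)]
    have h2 : |ε * a| * (2 * crossAngle x₀) ≤ |ε| * C * 8 :=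
      mul_le_mul (abs_eps_mul_a_le hB) (by linarith [crossAngle_le_pi x₀, Real.pi_le_four])
        (by linarith [crossAngle_nonneg x₀]) hp2
    nlinarith
  · have h1 : (crossingMap a ε S (x₀, x₀)).2 =
        ((S (upperCrossing x₀) - V (upperCrossing x₀)) -
          (S (lowerCrossing x₀) - V (lowerCrossing x₀))).im := by
      rw [melnikov] at hM
      simp only [crossingMap] at hM ⊢
      simp only [Complex.sub_im]
      linarith
    rw [h1]
    refine (Complex.abs_im_le_norm _).trans ?_
    have h2 := norm_primitive_sub_le hB hε hV hS (lowerCrossing_mem hB hx) (upperCrossing_mem hB hx)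
    have h3 : ‖upperCrossing x₀ - lowerCrossing x₀‖ ≤ 16 := by
      have h4 := norm_sub_le_norm_sub_add_norm_sub (upperCrossing x₀) (x₀ : ℂ) (lowerCrossing x₀)
      rw [norm_sub_rev (x₀ : ℂ)] at h4
      linarith [norm_upperCrossing_sub_le hB hx, norm_lowerCrossing_sub_le hB hx]
    have h5 : 2 * (|ε| * C) * C * ‖upperCrossing x₀ - lowerCrossing x₀‖ ≤
        2 * (|ε| * C) * C * 16 := mul_le_mul_of_nonneg_left h3 (by positivity)
    nlinarith

/-- A simple zero `x₀` of the displacement function produces, for every small `ε ≠ 0`, a periodic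
orbit close to the circle `log |z - 1| = x₀`, which is the only one in a fixed annulus. -/
theorem exists_isPeriodicOrbit_near {h : Zone → Polynomial ℂ} (hh : HasLogForm h a q)
    (hqp : ∀ v, q (v + 2 * Real.pi * Complex.I) = q v) (hq : Differentiable ℂ q)
    (hV : ∀ u, HasDerivAt V (q u) u) (hx₀ : x₀ < Real.log 2)
    (hM : melnikov a V x₀ = 0) {m : ℝ} (hm : m ≠ 0) (hM' : HasDerivAt (melnikov a V) m x₀) :
    ∃ δ₀ > 0, ∀ δ > 0, ∃ ε₁ > 0, ∀ ε : ℝ, 0 < |ε| → |ε| < ε₁ →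
      ∃ Γ, IsPeriodicOrbit (perturbedCenter h ε) Γ ∧ Γ ⊆ logAnnulus x₀ δ ∧
        Γ ⊆ logAnnulus x₀ δ₀ ∧
        (∀ Γ', IsPeriodicOrbit (perturbedCenter h ε) Γ' → Γ' ⊆ logAnnulus x₀ δ₀ → Γ' = Γ) ∧
        ∀ θ : ℝ, ∃ x : ℝ, |x - x₀| < δ ∧ Complex.exp (x + θ * Complex.I) + 1 ∈ Γ := by
  obtain ⟨f', hf'⟩ := exists_hasStrictFDerivAt_crossingMap hx₀ (fun u => (hV u).differentiableAt)
    hm hM'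
  obtain ⟨R₁, hR₁, hzero⟩ := exists_zero_of_lipschitz_perturbation hf'
  obtain ⟨R₂, hR₂, L, C, d, hbounds⟩ := exists_annulusBounds (a := a) hx₀ hq
  have hδ₀ : 0 < min R₁ R₂ := lt_min hR₁ hR₂
  refine ⟨min R₁ R₂, hδ₀, fun δ' hδ' => ?_⟩
  set δ₀ := min R₁ R₂
  set δ := min δ' δ₀
  have hδ : 0 < δ := lt_min hδ' hδ₀
  have hB₀ := hbounds δ₀ hδ₀ (min_le_right _ _)
  have hB := hbounds δ hδ ((min_le_right _ _).trans (min_le_right _ _))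
  obtain ⟨κ, hκ, hκ'⟩ := hzero δ₀ hδ₀ (min_le_left _ _) (δ / 2) (by positivity)
  obtain ⟨ε₁, hε₁, hsmall⟩ := exists_smallParam hδ hB.lip_nonneg hB.C_nonneg hB.gap_pos
  have hden : 0 < 40 * (1 + C) ^ 2 * (1 + L) := by
    have := hB.lip_nonneg
    have := hB.C_nonneg
    positivity
  refine ⟨min ε₁ (κ / (40 * (1 + C) ^ 2 * (1 + L))), lt_min hε₁ (by positivity),
    fun ε hε hlt => ?_⟩
  have hs := hsmall ε hε (hlt.trans_le (min_le_left _ _))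
  have hs₀ : SmallParam ε δ₀ L C d :=
    ⟨hs.ne_zero, hs.lip, hs.gap, hs.drift.trans (min_le_right _ _)⟩
  have hεκ : |ε| * (40 * (1 + C) ^ 2 * (1 + L)) ≤ κ := by
    have := hlt.trans_le (min_le_right _ _)
    rw [lt_div_iff₀ hden] at this
    exact this.le
  obtain ⟨S, hS⟩ := exists_isTimePrimitive hB hs
  obtain ⟨hinj, ⟨x, y⟩, hz, hz0⟩ := hκ' (crossingMap a ε S)
    (fun z hz w hw => (norm_crossingMap_sub_le hB₀ hs₀ hV hS hz hw).trans
      (mul_le_mul_of_nonneg_right hεκ (norm_nonneg _)))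
    ((norm_crossingMap_center_le hB hs hV hS hM).trans hεκ)
  rw [Metric.mem_ball, Prod.dist_eq, max_lt_iff, Real.dist_eq, Real.dist_eq] at hz
  have hxy := (linked_iff hs.ne_zero).mpr hz0
  obtain ⟨Γ, hΓ, hsub⟩ := hxy.exists_isPeriodicOrbit hB hs hqp hh hS hz.1
    (hz.2.trans (by linarith))
  have hmono : ∀ {r s : ℝ}, r ≤ s → logAnnulus x₀ r ⊆ logAnnulus x₀ s :=
    fun hrs z hz => ⟨hz.1, hz.2.trans_le hrs⟩
  have hsub₀ := hsub.trans (hmono (min_le_right δ' δ₀))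
  -- In the fixed annulus every periodic orbit comes from the unique zero of the crossing map.
  have huniq : ∀ Γ', IsPeriodicOrbit (perturbedCenter h ε) Γ' → Γ' ⊆ logAnnulus x₀ δ₀ →
      Γ' = (fun w => w + 1) '' returnCurve a ε S x₀ x y := by
    intro Γ' hΓ' hsub'
    obtain ⟨x', y', hx', hy', hxy', rfl⟩ := hΓ'.eq_image_returnCurve hB₀ hs₀ hqp hh hS hsub'
    have h1 := (linked_iff hs.ne_zero).mp hxy'
    have hδδ₀ : δ ≤ δ₀ := min_le_right _ _
    have h2 : (x', y') = (x, y) := hinj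
      (by rw [Metric.mem_ball, Prod.dist_eq, max_lt_iff, Real.dist_eq, Real.dist_eq]
          exact ⟨hx', hy'⟩)
      (by rw [Metric.mem_ball, Prod.dist_eq, max_lt_iff, Real.dist_eq, Real.dist_eq]
          exact ⟨hz.1.trans (by linarith), hz.2.trans (by linarith)⟩)
      (h1.trans hz0.symm)
    rw [(Prod.mk.inj h2).1, (Prod.mk.inj h2).2]
  refine ⟨Γ, hΓ, hsub.trans (hmono (min_le_left _ _)), hsub₀, fun Γ' hΓ' hsub' => ?_, fun θ => ?_⟩
  · rw [huniq Γ' hΓ' hsub', huniq Γ hΓ hsub₀]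
  · obtain ⟨r, hr, hmem⟩ := hΓ.exists_mem_ray hB hs hh hsub θ
    exact ⟨r, hr.trans_le (min_le_left _ _), hmem⟩

end

/-! ### Displacement functions with five simple zeros -/

/-- The functions spanning the displacement functions, in the variable `X = ρ / 2 ∈ (0, 1)`. -/
noncomputable def displacementBasis : Fin 6 → ℝ → ℝ :=
  ![fun _ => 1, fun X => Real.arccos (-X), fun X => √(1 - X ^ 2) * X⁻¹,
    fun X => √(1 - X ^ 2) * X, fun X => √(1 - X ^ 2) * X ^ 3, fun X => √(1 - X ^ 2) * X ^ 5]

/-- The displacement function with coefficients `k`. -/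
noncomputable def displacement (k : Fin 6 → ℝ) (X : ℝ) : ℝ := ∑ j, k j * displacementBasis j X

/-- The numerator of the derivative of `displacement k`, a polynomial in `X²`. -/
noncomputable def displacementNumerator (k : Fin 6 → ℝ) : Polynomial ℝ :=
  Polynomial.C (-k 2) + Polynomial.C (k 1 + k 3) * Polynomial.X +
    Polynomial.C (3 * k 4 - 2 * k 3) * Polynomial.X ^ 2 +
    Polynomial.C (5 * k 5 - 4 * k 4) * Polynomial.X ^ 3 +
    Polynomial.C (-6 * k 5) * Polynomial.X ^ 4

theorem displacement_eq (k : Fin 6 → ℝ) (X : ℝ) : displacement k X =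
    k 0 + k 1 * Real.arccos (-X) +
      √(1 - X ^ 2) * (k 2 * X⁻¹ + k 3 * X + k 4 * X ^ 3 + k 5 * X ^ 5) := by
  simp only [displacement, displacementBasis, Fin.sum_univ_succ, Fin.sum_univ_zero]
  simp [Fin.succ, Matrix.cons_val]
  ring

theorem hasDerivAt_displacement (k : Fin 6 → ℝ) {X : ℝ} (h0 : 0 < X) (h1 : X < 1) :
    HasDerivAt (displacement k)
      ((displacementNumerator k).eval (X ^ 2) / (X ^ 2 * √(1 - X ^ 2))) X := by
  have hpos : 0 < 1 - X ^ 2 := by nlinarith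
  have hs : 0 < √(1 - X ^ 2) := Real.sqrt_pos.mpr hpos
  have hsq : √(1 - X ^ 2) ^ 2 = 1 - X ^ 2 := Real.sq_sqrt hpos.le
  have hfun : displacement k = fun X => k 0 + k 1 * Real.arccos (-X) +
      √(1 - X ^ 2) * (k 2 * X⁻¹ + k 3 * X + k 4 * X ^ 3 + k 5 * X ^ 5) :=
    funext (displacement_eq k)
  rw [hfun]
  have hX := hasDerivAt_id X
  have ha : HasDerivAt (fun X => Real.arccos (-X)) (1 / √(1 - X ^ 2)) X := by
    have := (Real.hasDerivAt_arccos (x := -X) (by linarith) (by linarith)).comp X hX.neg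
    convert! this using 1
    rw [neg_sq]
    ring
  have hr : HasDerivAt (fun X => √(1 - X ^ 2)) (-X / √(1 - X ^ 2)) X := by
    have := ((hX.pow 2).const_sub 1).sqrt hpos.ne'
    convert! this using 1
    simp
    field_simp
  have hp : HasDerivAt (fun X => k 2 * X⁻¹ + k 3 * X + k 4 * X ^ 3 + k 5 * X ^ 5)
      (k 2 * -(X ^ 2)⁻¹ + k 3 + k 4 * (3 * X ^ 2) + k 5 * (5 * X ^ 4)) X := by
    have := ((((hasDerivAt_inv h0.ne').const_mul (k 2)).add (hX.const_mul (k 3))).add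
      ((hasDerivAt_pow 3 X).const_mul (k 4))).add ((hasDerivAt_pow 5 X).const_mul (k 5))
    convert! this using 1
    norm_num
  convert! ((ha.const_mul (k 1)).const_add (k 0)).add (hr.mul hp) using 1
  simp only [displacementNumerator, Polynomial.eval_add, Polynomial.eval_mul, Polynomial.eval_C,
    Polynomial.eval_X, Polynomial.eval_pow]
  field_simp
  rw [hsq]
  ring

/-- Five linear conditions on six coefficients have a nonzero solution. -/
theorem exists_displacement_zeros (X : Fin 5 → ℝ) :
    ∃ k : Fin 6 → ℝ, k ≠ 0 ∧ ∀ i, displacement k (X i) = 0 := by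
  set A := Matrix.mulVecLin (Matrix.of fun i j => displacementBasis j (X i)) with hA
  have hker : LinearMap.ker A ≠ ⊥ := LinearMap.ker_ne_bot_of_finrank_lt (by simp)
  obtain ⟨k, hk, hk0⟩ := Submodule.exists_mem_ne_zero_of_ne_bot hker
  refine ⟨k, hk0, fun i => ?_⟩
  have h1 : A k i = 0 := congrFun (LinearMap.mem_ker.mp hk) i
  rw [displacement, ← h1]
  simp only [hA, Matrix.mulVecLin_apply, Matrix.mulVec, dotProduct, Matrix.of_apply]
  exact Finset.sum_congr rfl fun j _ => mul_comm _ _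

/-- Five zeros in `(0, 1)` of a nonzero displacement function are simple: with a double one Rolle's
theorem would give five roots to the numerator of the derivative, of degree four. -/
theorem displacementNumerator_eval_ne_zero {k : Fin 6 → ℝ} (hk : k ≠ 0) {X : Fin 5 → ℝ}
    (hX : StrictMono X) (h0 : ∀ i, 0 < X i) (h1 : ∀ i, X i < 1)
    (hz : ∀ i, displacement k (X i) = 0) (j : Fin 5) :
    (displacementNumerator k).eval (X j ^ 2) ≠ 0 := by
  intro hj
  have hrolle : ∀ i : Fin 4, ∃ ξ ∈ Set.Ioo (X i.castSucc) (X i.succ),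
      (displacementNumerator k).eval (ξ ^ 2) = 0 := by
    intro i
    have hd : ∀ ξ ∈ Set.Icc (X i.castSucc) (X i.succ), HasDerivAt (displacement k)
        ((displacementNumerator k).eval (ξ ^ 2) / (ξ ^ 2 * √(1 - ξ ^ 2))) ξ := fun ξ hξ =>
      hasDerivAt_displacement k ((h0 _).trans_le hξ.1) (hξ.2.trans_lt (h1 _))
    obtain ⟨ξ, hξ, hξ0⟩ := exists_hasDerivAt_eq_zero (hX (Fin.castSucc_lt_succ (i := i)))
      (fun ξ hξ => (hd ξ hξ).continuousAt.continuousWithinAt) (by rw [hz, hz])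
      (fun ξ hξ => hd ξ (Set.Ioo_subset_Icc_self hξ))
    refine ⟨ξ, hξ, ?_⟩
    have hp : 0 < ξ := (h0 _).trans hξ.1
    have hp1 : ξ < 1 := hξ.2.trans (h1 _)
    have hs : 0 < √(1 - ξ ^ 2) := Real.sqrt_pos.mpr (by nlinarith)
    exact (div_eq_zero_iff.mp hξ0).resolve_right (by positivity)
  choose ξ hξ hξ0 using hrolle
  have hξmono : StrictMono ξ := by
    intro i i' hii'
    have : X i.succ ≤ X i'.castSucc := hX.monotone (by
      rw [Fin.le_def]
      simpa using hii')
    linarith [(hξ i).2, (hξ i').1]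
  have hne : X j ∉ Set.range ξ := by
    rintro ⟨i, hi⟩
    have h2 := (hξ i).1
    have h3 := (hξ i).2
    rw [hi, hX.lt_iff_lt, Fin.lt_def] at h2 h3
    simp at h2 h3
    omega
  have hinj : Function.Injective (Fin.cons (X j) ξ : Fin 5 → ℝ) :=
    Fin.cons_injective_iff.mpr ⟨hne, hξmono.injective⟩
  have hpos : ∀ i, 0 < (Fin.cons (X j) ξ : Fin 5 → ℝ) i := by
    intro i
    refine Fin.cases ?_ (fun i => ?_) i
    · simpa using h0 j
    · simpa using (h0 _).trans (hξ i).1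
  have hR : displacementNumerator k = 0 := by
    refine Polynomial.eq_zero_of_natDegree_lt_card_of_eval_eq_zero (displacementNumerator k)
      (f := fun i => (Fin.cons (X j) ξ : Fin 5 → ℝ) i ^ 2) (fun i i' h => ?_) (fun i => ?_) ?_
    · exact hinj ((sq_eq_sq₀ (hpos i).le (hpos i').le).mp h)
    · refine Fin.cases ?_ (fun i => ?_) i
      · simpa using hj
      · simpa using hξ0 i
    · have : (displacementNumerator k).natDegree ≤ 4 := by
        unfold displacementNumerator
        compute_degree
      rw [Fintype.card_fin]
      omega
  have hev : ∀ r, (displacementNumerator k).eval r = 0 := by simp [hR]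
  simp only [displacementNumerator, Polynomial.eval_add, Polynomial.eval_mul, Polynomial.eval_C,
    Polynomial.eval_X, Polynomial.eval_pow] at hev
  have e0 := hev 0
  have e1 := hev 1
  have e2 := hev (-1)
  have e3 := hev 2
  have e4 := hev (-2)
  norm_num at e0 e1 e2 e3 e4
  have k5 : k 5 = 0 := by linarith
  have k4 : k 4 = 0 := by linarith
  have k3 : k 3 = 0 := by linarith
  have k1 : k 1 = 0 := by linarith
  have k0 : k 0 = 0 := by
    have := hz 0
    rw [displacement_eq, k1, e0, k3, k4, k5] at this
    simpa using this
  apply hk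
  funext i
  fin_cases i
  exacts [k0, k1, e0, k3, k4, k5]

/-- The inner field `q(u) = p(e^u) e^{-u}` of the polynomial `p(w) = ∑ c k w^k`. -/
noncomputable def innerField (c : Fin 5 → ℝ) (u : ℂ) : ℂ :=
  c 0 * Complex.exp (-u) + c 1 + c 2 * Complex.exp u + c 3 * Complex.exp u ^ 2 +
    c 4 * Complex.exp u ^ 3

/-- A primitive of `innerField c`. -/
noncomputable def innerPrimitive (c : Fin 5 → ℝ) (u : ℂ) : ℂ :=
  -c 0 * Complex.exp (-u) + c 1 * u + c 2 * Complex.exp u + c 3 / 2 * Complex.exp u ^ 2 +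
    c 4 / 3 * Complex.exp u ^ 3

theorem hasDerivAt_innerPrimitive (c : Fin 5 → ℝ) (u : ℂ) :
    HasDerivAt (innerPrimitive c) (innerField c u) u := by
  have hid := hasDerivAt_id u
  have he := Complex.hasDerivAt_exp u
  have := ((((hid.neg.cexp.const_mul (-c 0 : ℂ)).add (hid.const_mul (c 1 : ℂ))).add
    (he.const_mul (c 2 : ℂ))).add ((he.pow 2).const_mul (c 3 / 2 : ℂ))).add
    ((he.pow 3).const_mul (c 4 / 3 : ℂ))
  convert! this using 1
  simp [innerField]
  ring

theorem differentiable_innerField (c : Fin 5 → ℝ) : Differentiable ℂ (innerField c) := by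
  unfold innerField
  fun_prop

theorem innerField_periodic (c : Fin 5 → ℝ) (u : ℂ) :
    innerField c (u + 2 * Real.pi * Complex.I) = innerField c u := by
  have h : Complex.exp (u + 2 * Real.pi * Complex.I) = Complex.exp u := by
    rw [Complex.exp_add, Complex.exp_two_pi_mul_I, mul_one]
  simp only [innerField, Complex.exp_neg, h]

theorem im_exp_nat_mul (n : ℕ) (z : ℂ) :
    (Complex.exp z ^ n).im = Real.exp z.re ^ n * Real.sin (n * z.im) := by
  rw [← Complex.exp_nat_mul, Complex.exp_im, ← Real.exp_nat_mul]
  simp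

theorem innerPrimitive_im (c : Fin 5 → ℝ) (z : ℂ) : (innerPrimitive c z).im =
    c 0 * ((Real.exp z.re)⁻¹ * Real.sin z.im) + c 1 * z.im + c 2 * (Real.exp z.re * Real.sin z.im) +
      c 3 / 2 * (Real.exp z.re ^ 2 * Real.sin (2 * z.im)) +
      c 4 / 3 * (Real.exp z.re ^ 3 * Real.sin (3 * z.im)) := by
  have h2 := im_exp_nat_mul 2 z
  have h3 := im_exp_nat_mul 3 z
  have e2 : (c 3 / 2 : ℂ) = ((c 3 / 2 : ℝ) : ℂ) := by push_cast; rfl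
  have e3 : (c 4 / 3 : ℂ) = ((c 4 / 3 : ℝ) : ℂ) := by push_cast; rfl
  have e0 : (-c 0 : ℂ) = ((-c 0 : ℝ) : ℂ) := by push_cast; rfl
  rw [innerPrimitive, e0, e2, e3]
  simp only [Complex.add_im, Complex.im_ofReal_mul]
  rw [h2, h3, Complex.exp_im, Complex.exp_im, Complex.neg_re, Complex.neg_im, Real.sin_neg,
    Real.exp_neg]
  push_cast
  ring

/-- The displacement function of the polynomial perturbation, in the variable `X = e^x / 2`. -/
theorem melnikov_innerPrimitive (a : ℝ) (c : Fin 5 → ℝ) {x : ℝ} (hx : x < Real.log 2) :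
    melnikov a (innerPrimitive c) x =
      displacement ![-(2 * Real.pi * c 1), 2 * c 1 - 2 * a, c 0, 4 * c 2,
        -(8 * c 3) - 16 / 3 * c 4, 64 / 3 * c 4] (Real.exp x / 2) := by
  have hcos := cos_crossAngle hx
  have hsin : Real.sin (crossAngle x) = √(1 - (Real.exp x / 2) ^ 2) := by
    rw [crossAngle, Real.sin_arccos]
    congr 1
    ring
  have harc : crossAngle x = Real.arccos (-(Real.exp x / 2)) := by
    rw [crossAngle, neg_div]
  have hsin2 : Real.sin (2 * crossAngle x) = √(1 - (Real.exp x / 2) ^ 2) * -(Real.exp x) := by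
    rw [Real.sin_two_mul, hcos, hsin]
    ring
  have hsin3 : Real.sin (3 * crossAngle x) =
      √(1 - (Real.exp x / 2) ^ 2) * (Real.exp x ^ 2 - 1) := by
    have h1 := Real.sin_sq (crossAngle x)
    rw [hcos] at h1
    rw [Real.sin_three_mul, ← hsin]
    linear_combination -4 * Real.sin (crossAngle x) * h1
  have hl1 : Real.sin (2 * Real.pi - crossAngle x) = -Real.sin (crossAngle x) :=
    Real.sin_two_pi_sub _
  have hl2 : Real.sin (2 * (2 * Real.pi - crossAngle x)) = -Real.sin (2 * crossAngle x) := by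
    rw [← Real.sin_neg, ← Real.sin_add_int_mul_two_pi (-(2 * crossAngle x)) 2]
    congr 1
    push_cast
    ring
  have hl3 : Real.sin (3 * (2 * Real.pi - crossAngle x)) = -Real.sin (3 * crossAngle x) := by
    rw [← Real.sin_neg, ← Real.sin_add_int_mul_two_pi (-(3 * crossAngle x)) 3]
    congr 1
    push_cast
    ring
  rw [displacement_eq, ← harc]
  simp only [melnikov, crossingMap, innerPrimitive_im, upperCrossing, lowerCrossing]
  rw [hl1, hl2, hl3, hsin2, hsin3, hsin]
  have he := (Real.exp_pos x).ne'
  simp [Matrix.cons_val]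
  field_simp
  ring

/-- There are a polynomial perturbation and five radii at which its displacement function has
simple zeros. -/
theorem exists_melnikov_zeros {X : Fin 5 → ℝ} (hX : StrictMono X) (h0 : ∀ i, 0 < X i)
    (h1 : ∀ i, X i < 1) :
    ∃ (a : ℝ) (c : Fin 5 → ℝ), ∀ i, melnikov a (innerPrimitive c) (Real.log (2 * X i)) = 0 ∧
      ∃ m, m ≠ 0 ∧ HasDerivAt (melnikov a (innerPrimitive c)) m (Real.log (2 * X i)) := by
  obtain ⟨k, hk, hz⟩ := exists_displacement_zeros X
  have hπ := Real.pi_ne_zero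
  -- The inverse of the coefficient map in `melnikov_innerPrimitive`.
  set c : Fin 5 → ℝ := ![k 2, -(k 0 / (2 * Real.pi)), k 3 / 4, -(k 4 + k 5 / 4) / 8,
    3 / 64 * k 5] with hc
  set a : ℝ := -(k 0 / (2 * Real.pi)) - k 1 / 2 with ha
  have hkc : ![-(2 * Real.pi * c 1), 2 * c 1 - 2 * a, c 0, 4 * c 2,
      -(8 * c 3) - 16 / 3 * c 4, 64 / 3 * c 4] = k := by
    funext i
    fin_cases i <;> simp [hc, ha] <;> field_simp <;> ring
  have hM : ∀ x, x < Real.log 2 →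
      melnikov a (innerPrimitive c) x = displacement k (Real.exp x / 2) := by
    intro x hx
    rw [melnikov_innerPrimitive a c hx, hkc]
  refine ⟨a, c, fun i => ?_⟩
  have hpos : 0 < 2 * X i := by linarith [h0 i]
  have hlt : Real.log (2 * X i) < Real.log 2 := Real.log_lt_log hpos (by linarith [h1 i])
  have hexp : Real.exp (Real.log (2 * X i)) / 2 = X i := by
    rw [Real.exp_log hpos]
    ring
  refine ⟨by rw [hM _ hlt, hexp, hz i],
    (displacementNumerator k).eval (X i ^ 2) / (X i ^ 2 * √(1 - X i ^ 2)) * X i, ?_, ?_⟩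
  · have h5 := displacementNumerator_eval_ne_zero hk hX h0 h1 hz i
    have h6 : 0 < √(1 - X i ^ 2) := Real.sqrt_pos.mpr (by nlinarith [h0 i, h1 i])
    have h7 := (h0 i).ne'
    positivity
  · have h2 : HasDerivAt (fun x => Real.exp x / 2) (X i) (Real.log (2 * X i)) := by
      have := (Real.hasDerivAt_exp (Real.log (2 * X i))).div_const 2
      rwa [hexp] at this
    have h3 := hasDerivAt_displacement k (h0 i) (h1 i)
    rw [← hexp] at h3
    have h4 := h3.comp (Real.log (2 * X i)) h2
    rw [hexp] at h4
    refine h4.congr_of_eventuallyEq ?_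
    filter_upwards [Iio_mem_nhds hlt] with x hx using hM x hx

/-! ### Limit cycles and Hausdorff convergence -/

theorem isOpen_logAnnulus (x₀ δ : ℝ) : IsOpen (logAnnulus x₀ δ) := by
  have h1 : IsOpen {z : ℂ | z ≠ 1} := isOpen_ne
  have hc : ContinuousOn (fun z : ℂ => |Real.log ‖z - 1‖ - x₀|) {z : ℂ | z ≠ 1} := by
    refine ContinuousOn.abs (ContinuousOn.sub (ContinuousOn.log (by fun_prop) fun z hz => ?_)
      continuousOn_const)
    exact norm_ne_zero_iff.mpr (sub_ne_zero.mpr hz)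
  exact hc.isOpen_inter_preimage h1 (isOpen_Iio (a := δ))

/-- A set in a thin annulus about the circle `|z - 1| = e^{x₀}` which meets every ray from the
centre close to that circle is close to it in the Hausdorff distance. -/
theorem hausdorffEDist_sphere_le {Γ : Set ℂ} {x₀ δ : ℝ} {η : NNReal}
    (hη : ∀ x : ℝ, |x - x₀| < δ → |Real.exp x - Real.exp x₀| ≤ η)
    (hsub : Γ ⊆ logAnnulus x₀ δ)
    (hray : ∀ θ : ℝ, ∃ x : ℝ, |x - x₀| < δ ∧ Complex.exp (x + θ * Complex.I) + 1 ∈ Γ) :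
    Metric.hausdorffEDist Γ (Metric.sphere (1 : ℂ) (Real.exp x₀)) ≤ η := by
  have hdist : ∀ x y θ : ℝ, dist (Complex.exp (x + θ * Complex.I) + 1)
      (Complex.exp (y + θ * Complex.I) + 1) = |Real.exp x - Real.exp y| := by
    intro x y θ
    rw [dist_eq_norm, add_sub_add_right_eq_sub, Complex.exp_add, Complex.exp_add, ← sub_mul,
      norm_mul, Complex.norm_exp_ofReal_mul_I, mul_one, ← Complex.ofReal_exp,
      ← Complex.ofReal_exp, ← Complex.ofReal_sub, Complex.norm_real, Real.norm_eq_abs]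
  have hpolar : ∀ z : ℂ, z ≠ 1 →
      Complex.exp (Real.log ‖z - 1‖ + (z - 1).arg * Complex.I) + 1 = z := by
    intro z hz
    have h1 : Complex.exp (Complex.log (z - 1)) = z - 1 := Complex.exp_log (sub_ne_zero.mpr hz)
    rw [Complex.log] at h1
    rw [h1, sub_add_cancel]
  have hedist : ∀ z w : ℂ, dist z w ≤ η → edist z w ≤ η := by
    intro z w h
    rw [edist_nndist]
    exact_mod_cast h
  refine Metric.hausdorffEDist_le_of_mem_edist (fun z hz => ?_) fun z hz => ?_
  · obtain ⟨h1, h2⟩ := hsub hz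
    refine ⟨Complex.exp (x₀ + (z - 1).arg * Complex.I) + 1, ?_, hedist _ _ ?_⟩
    · rw [mem_sphere_iff_norm, add_sub_cancel_right, Complex.norm_exp]
      simp
    · nth_rewrite 1 [← hpolar z h1]
      rw [hdist]
      exact hη _ h2
  · rw [mem_sphere_iff_norm] at hz
    have hz1 : z ≠ 1 := by
      rintro rfl
      rw [sub_self, norm_zero] at hz
      exact (Real.exp_pos x₀).ne hz
    obtain ⟨x, hx, hmem⟩ := hray (z - 1).arg
    refine ⟨_, hmem, hedist _ _ ?_⟩
    nth_rewrite 1 [← hpolar z hz1]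
    rw [hdist, hz, Real.log_exp, abs_sub_comm]
    exact hη x hx

/-- A simple zero of the displacement function is the radius of a circle from which a family of
limit cycles bifurcates. -/
theorem exists_limitCycle_family {a x₀ : ℝ} {q V : ℂ → ℂ} {h : Zone → Polynomial ℂ}
    (hh : HasLogForm h a q)
    (hqp : ∀ v, q (v + 2 * Real.pi * Complex.I) = q v) (hq : Differentiable ℂ q)
    (hV : ∀ u, HasDerivAt V (q u) u) (hx₀ : x₀ < Real.log 2)
    (hM : melnikov a V x₀ = 0) {m : ℝ} (hm : m ≠ 0) (hM' : HasDerivAt (melnikov a V) m x₀) :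
    ∃ Γ : ℝ → Set ℂ,
      (∀ᶠ ε in nhdsWithin 0 {0}ᶜ, IsLimitCycle (perturbedCenter h ε) (Γ ε)) ∧
      (∀ δ > 0, ∀ᶠ ε in nhdsWithin 0 {0}ᶜ, Γ ε ⊆ logAnnulus x₀ δ) ∧
      Filter.Tendsto (fun ε => Metric.hausdorffEDist (Γ ε) (Metric.sphere (1 : ℂ) (Real.exp x₀)))
        (nhdsWithin 0 {0}ᶜ) (nhds 0) := by
  obtain ⟨δ₀, hδ₀, hnear⟩ := exists_isPeriodicOrbit_near hh hqp hq hV hx₀ hM hm hM'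
  have hev : ∀ ε₁ > 0, ∀ᶠ ε : ℝ in nhdsWithin 0 {0}ᶜ, 0 < |ε| ∧ |ε| < ε₁ := by
    intro ε₁ hε₁
    filter_upwards [self_mem_nhdsWithin,
      mem_nhdsWithin_of_mem_nhds (Metric.ball_mem_nhds (0 : ℝ) hε₁)] with ε h1 h2
    rw [mem_ball_zero_iff, Real.norm_eq_abs] at h2
    exact ⟨abs_pos.mpr h1, h2⟩
  obtain ⟨ε₁, hε₁, hfam⟩ := hnear δ₀ hδ₀
  choose! Γ hΓ using hfam
  -- By uniqueness in the fixed annulus, the orbit found in a thinner annulus is the same one.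
  have hthin : ∀ δ > 0, ∀ᶠ ε in nhdsWithin 0 {0}ᶜ, Γ ε ⊆ logAnnulus x₀ δ ∧
      ∀ θ : ℝ, ∃ x : ℝ, |x - x₀| < δ ∧ Complex.exp (x + θ * Complex.I) + 1 ∈ Γ ε := by
    intro δ hδ
    obtain ⟨ε₂, hε₂, hfam'⟩ := hnear δ hδ
    filter_upwards [hev ε₁ hε₁, hev ε₂ hε₂] with ε h1 h2
    obtain ⟨Γ', hΓ', hsub, hsub₀, -, hray⟩ := hfam' ε h2.1 h2.2
    obtain ⟨-, -, -, huniq, -⟩ := hΓ ε h1.1 h1.2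
    rw [← huniq Γ' hΓ' hsub₀]
    exact ⟨hsub, hray⟩
  refine ⟨Γ, ?_, fun δ hδ => (hthin δ hδ).mono fun ε h => h.1, ?_⟩
  · filter_upwards [hev ε₁ hε₁] with ε h1
    obtain ⟨hper, hsub, -, huniq, -⟩ := hΓ ε h1.1 h1.2
    exact ⟨hper, logAnnulus x₀ δ₀, isOpen_logAnnulus x₀ δ₀, hsub, huniq⟩
  · rw [ENNReal.tendsto_nhds_zero]
    intro η hη
    obtain ⟨η', hη'0, hη'⟩ := ENNReal.lt_iff_exists_nnreal_btwn.mp hη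
    have hη'pos : (0 : ℝ) < η' := by exact_mod_cast hη'0
    obtain ⟨δ, hδ, hexp⟩ := Metric.continuousAt_iff.mp
      (Real.continuous_exp.continuousAt (x := x₀)) η' hη'pos
    filter_upwards [hthin δ hδ] with ε hε
    refine (hausdorffEDist_sphere_le (η := η') (fun x hx => ?_) hε.1 hε.2).trans hη'.le
    have := hexp (x := x) (by rwa [Real.dist_eq])
    rw [Real.dist_eq] at this
    exact this.le

/-- The polynomials of the three zones: `a (z - 1)` outside, `∑ c k (z - 1)^k` inside the disc
`|z| < 1`. -/
noncomputable def zonePolynomial (a : ℝ) (c : Fin 5 → ℝ) : Zone → Polynomial ℂ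
  | Zone.plus => (Polynomial.C (c 0 : ℂ) + Polynomial.C (c 1 : ℂ) * Polynomial.X +
      Polynomial.C (c 2 : ℂ) * Polynomial.X ^ 2 + Polynomial.C (c 3 : ℂ) * Polynomial.X ^ 3 +
      Polynomial.C (c 4 : ℂ) * Polynomial.X ^ 4).comp (Polynomial.X - Polynomial.C 1)
  | Zone.center => Polynomial.C (a : ℂ) * (Polynomial.X - Polynomial.C 1)
  | Zone.minus => Polynomial.C (a : ℂ) * (Polynomial.X - Polynomial.C 1)

theorem natDegree_zonePolynomial_le (a : ℝ) (c : Fin 5 → ℝ) (σ : Zone) :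
    (zonePolynomial a c σ).natDegree ≤ 4 := by
  have hlin : (Polynomial.C (a : ℂ) * (Polynomial.X - Polynomial.C 1)).natDegree ≤ 4 := by
    have : (Polynomial.C (a : ℂ) * (Polynomial.X - Polynomial.C 1)).natDegree ≤ 1 := by
      compute_degree
    omega
  cases σ with
  | plus =>
    refine Polynomial.natDegree_comp_le.trans ?_
    rw [Polynomial.natDegree_X_sub_C, mul_one]
    compute_degree
  | center => exact hlin
  | minus => exact hlin

theorem hasLogForm_zonePolynomial (a : ℝ) (c : Fin 5 → ℝ) :
    HasLogForm (zonePolynomial a c) a (innerField c) := by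
  refine ⟨rfl, fun z => by simp [zonePolynomial], fun u => ?_⟩
  have he := Complex.exp_ne_zero u
  simp only [zonePolynomial, innerField, Polynomial.eval_comp, Polynomial.eval_add,
    Polynomial.eval_mul, Polynomial.eval_pow, Polynomial.eval_sub, Polynomial.eval_C,
    Polynomial.eval_X, add_sub_cancel_right, Complex.exp_neg]
  field_simp

theorem theoremB :
    ∃ h : Zone → Polynomial ℂ, (∀ σ, (h σ).natDegree ≤ 4) ∧
      ∃ ρ : Fin 5 → ℝ, Function.Injective ρ ∧ (∀ i, 0 < ρ i ∧ ρ i < 2) ∧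
        ∃ ε₀ : ℝ, 0 < ε₀ ∧ ∃ Γ : Fin 5 → ℝ → Set ℂ,
          (∀ ε : ℝ, 0 < |ε| → |ε| < ε₀ →
            (∀ i, IsLimitCycle (perturbedCenter h ε) (Γ i ε)) ∧
              Function.Injective (fun i => Γ i ε)) ∧
          ∀ i, Filter.Tendsto (fun ε => Metric.hausdorffEDist (Γ i ε) (Metric.sphere (1 : ℂ) (ρ i)))
            (nhdsWithin 0 {0}ᶜ) (nhds 0) := by
  set X : Fin 5 → ℝ := fun i => ((i : ℕ) + 1) / 6 with hX
  have hmono : StrictMono X := by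
    intro i j hij
    have : ((i : ℕ) : ℝ) < (j : ℕ) := by exact_mod_cast hij
    simp only [hX]
    linarith
  have h0 : ∀ i, 0 < X i := fun i => by simp only [hX]; positivity
  have h1 : ∀ i, X i < 1 := fun i => by
    have : ((i : ℕ) : ℝ) < 5 := by exact_mod_cast i.isLt
    simp only [hX]
    linarith
  obtain ⟨a, c, hz⟩ := exists_melnikov_zeros hmono h0 h1
  have hpos : ∀ i, 0 < 2 * X i := fun i => by linarith [h0 i]
  have hfam : ∀ i, ∃ Γ : ℝ → Set ℂ,
      (∀ᶠ ε in nhdsWithin 0 {0}ᶜ, IsLimitCycle (perturbedCenter (zonePolynomial a c) ε) (Γ ε)) ∧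
      (∀ δ > 0, ∀ᶠ ε in nhdsWithin 0 {0}ᶜ, Γ ε ⊆ logAnnulus (Real.log (2 * X i)) δ) ∧
      Filter.Tendsto (fun ε => Metric.hausdorffEDist (Γ ε) (Metric.sphere (1 : ℂ) (2 * X i)))
        (nhdsWithin 0 {0}ᶜ) (nhds 0) := by
    intro i
    obtain ⟨hM, m, hm, hM'⟩ := hz i
    have := exists_limitCycle_family (hasLogForm_zonePolynomial a c) (innerField_periodic c)
      (differentiable_innerField c) (hasDerivAt_innerPrimitive c)
      (Real.log_lt_log (hpos i) (by linarith [h1 i])) hM hm hM'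
    rwa [Real.exp_log (hpos i)] at this
  choose Γ hlim hsub htend using hfam
  have hinj : ∀ i j, i ≠ j → ∀ᶠ ε in nhdsWithin 0 {0}ᶜ, Γ i ε ≠ Γ j ε := by
    intro i j hij
    have hne : Real.log (2 * X i) - Real.log (2 * X j) ≠ 0 := by
      intro h
      have := Real.log_injOn_pos (hpos i) (hpos j) (sub_eq_zero.mp h)
      exact hij (hmono.injective (by linarith))
    have hd := abs_pos.mpr hne
    filter_upwards [hlim i, hsub i _ (half_pos hd), hsub j _ (half_pos hd)] with ε h2 h3 h4 heq
    obtain ⟨γ, -, -, -, -, -, hγ⟩ := h2.1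
    have hmem : γ 0 ∈ Γ i ε := hγ ▸ Set.mem_range_self 0
    have h5 := (h3 hmem).2
    have h6 := (h4 (heq ▸ hmem)).2
    have h7 := abs_sub_le (Real.log (2 * X i)) (Real.log ‖γ 0 - 1‖) (Real.log (2 * X j))
    rw [abs_sub_comm (Real.log (2 * X i)) (Real.log ‖γ 0 - 1‖)] at h7
    linarith
  have hall : ∀ᶠ ε in nhdsWithin 0 {0}ᶜ,
      (∀ i, IsLimitCycle (perturbedCenter (zonePolynomial a c) ε) (Γ i ε)) ∧
        ∀ i j, i ≠ j → Γ i ε ≠ Γ j ε := by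
    refine (Filter.eventually_all.mpr hlim).and ?_
    simp only [Filter.eventually_all]
    exact hinj
  obtain ⟨ε₀, hε₀, hball⟩ := Metric.mem_nhdsWithin_iff.mp hall
  refine ⟨zonePolynomial a c, natDegree_zonePolynomial_le a c, fun i => 2 * X i,
    fun i j hij => hmono.injective (mul_left_cancel₀ two_ne_zero hij),
    fun i => ⟨hpos i, by linarith [h1 i]⟩, ε₀, hε₀, Γ, fun ε h2 h3 => ?_, htend⟩
  obtain ⟨h4, h5⟩ := hball ⟨by rwa [mem_ball_zero_iff, Real.norm_eq_abs], abs_pos.mp h2⟩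
  exact ⟨h4, fun i j hij => by_contra fun hne => h5 i j hne hij⟩
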